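/- For integers $s\ge 1$ and $k\ge 0$ let $\mathrm{FC}_s(k)=\frac{1}{sk+1}\binom{sk+1}{k}$ be the Fuss–Catalan numbers of parameter $s$. For every $N\ge 1$ let $G_1,G_2,\dots$ be independent complex $N\times N$ Ginibre matrices, normalised so that the entries of all the matrices are independent and each has the law $\mathscr N_{\mathbb C}(0,\frac1N)$, that is, the law of $X+iY$ with $X,Y$ independent centred real Gaussian variables of variance $\frac1{2N}$. Let $w=G_{i_1}G_{i_2}\cdots G_{i_m}$ be a fixed word of length $m\ge 0$, with letters possibly repeated, let $G_w=\prod_{j=1}^m G_{i_j}$ be the resulting random matrix (the identity if $m=0$), and let $$\mu_{ww^*}=\frac1N\sum_{j=1}^N\delta_{\sigma_j^2}$$ be the empirical measure of the squares of the singular values $\sigma_1,\dots,\sigma_N$ of $G_w$, counted with multiplicity. Then there is exactly one probability measure $\rho_{FC}^{m+1}$ on $[0,\infty)$ all of whose moments are finite and given by $\int x^k\,d\rho_{FC}^{m+1}(x)=\mathrm{FC}_{m+1}(k)$ for all $k\ge 0$ (the Fuss–Catalan distribution with parameter $m+1$), and as $N\to\infty$ the random measures $\mu_{ww^*}$ converge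 weakly in probability to $\rho_{FC}^{m+1}$: for every bounded continuous $f:\mathbb R\to\mathbb R$ and every $\varepsilon>0$, $$\mathbb P\Bigl(\Bigl|\int f\,d\mu_{ww^*}-\int f\,d\rho_{FC}^{m+1}\Bigr|\ge\varepsilon\Bigr)\longrightarrow 0 .$$ -/

import Mathlib

open MeasureTheory ProbabilityTheory Filter Topology
open scoped NNReal ENNReal BoundedContinuousFunction

noncomputable section

/-- The centred complex Gaussian law `N_ℂ(0, v)`: the law of `X + iY` with `X`, `Y` independent
real centred Gaussian variables of variance `v / 2` each. -/
def complexGaussian (v : ℝ≥0) : Measure ℂ :=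
  ((gaussianReal 0 (v / 2)).prod (gaussianReal 0 (v / 2))).map
    (fun p : ℝ × ℝ => (p.1 : ℂ) + (p.2 : ℂ) * Complex.I)

/-- `G 0, G 1, G 2, …` are i.i.d. complex Ginibre matrices of order `N` on the probability space
`(Ω, P)`: all entries of all the matrices are independent, with law `N_ℂ(0, 1/N)`. -/
structure IsGinibreSequence {Ω : Type*} [MeasurableSpace Ω] {N : ℕ}
    (G : ℕ → Ω → Matrix (Fin N) (Fin N) ℂ) (P : Measure Ω) : Prop where
  hasLaw : ∀ (i : ℕ) (a b : Fin N),
    HasLaw (fun ω => G i ω a b) (complexGaussian ((N : ℝ≥0)⁻¹)) P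
  indep : iIndepFun (fun (p : ℕ × Fin N × Fin N) (ω : Ω) => G p.1 ω p.2.1 p.2.2) P

/-- The word `w = i₁ i₂ ⋯ i_m` evaluated at a sequence of square matrices:
the product `G_{i₁} G_{i₂} ⋯ G_{i_m}` (the identity matrix for the empty word). -/
def wordMatrix {N : ℕ} (G : ℕ → Matrix (Fin N) (Fin N) ℂ) (w : List ℕ) :
    Matrix (Fin N) (Fin N) ℂ :=
  (w.map G).prod

/-- The empirical measure `(1/N) ∑_j δ_{σ_j²}` of the squared singular values `σ_j²` of an `N × N`
matrix, counted with multiplicity (Mathlib's sequence of singular values starts at index `0`). -/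
def squaredSingularValueMeasure {N : ℕ} (A : Matrix (Fin N) (Fin N) ℂ) : Measure ℝ :=
  (N : ℝ≥0∞)⁻¹ • ∑ j : Fin N, Measure.dirac ((Matrix.toEuclideanLin A).singularValues j ^ 2)

/-- The Fuss-Catalan number `FC_s(n) = (1 / (s n + 1)) * binom(s n + 1, n)`. -/
def fussCatalan (s n : ℕ) : ℝ :=
  ((s * n + 1).choose n : ℝ) / ((s : ℝ) * n + 1)

/-- `ρ` is a Fuss-Catalan distribution with parameter `s`: a probability measure on `[0, ∞)`
whose `k`-th moment is finite and equal to `FC_s(k)` for every `k`. -/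
structure IsFussCatalan (s : ℕ) (ρ : Measure ℝ) : Prop where
  isProbabilityMeasure : IsProbabilityMeasure ρ
  nonneg : ρ (Set.Iio 0) = 0
  integrable_pow : ∀ k : ℕ, Integrable (fun x : ℝ => x ^ k) ρ
  moment_eq : ∀ k : ℕ, ∫ x, x ^ k ∂ρ = fussCatalan s k

/-- The random measures `μ N` on `ℝ`, where `μ N` is defined on the probability space `(Ω N, P N)`,
converge weakly, in probability, to the deterministic measure `ρ`. -/
def ConvergesWeaklyInProbability {Ω : ℕ → Type*} [∀ N, MeasurableSpace (Ω N)]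
    (P : ∀ N, Measure (Ω N)) (μ : ∀ N, Ω N → Measure ℝ) (ρ : Measure ℝ) : Prop :=
  ∀ f : ℝ →ᵇ ℝ, ∀ ε : ℝ, 0 < ε →
    Tendsto (fun N => P N {ω | ε ≤ |∫ x, f x ∂(μ N ω) - ∫ x, f x ∂ρ|}) atTop (𝓝 0)

end

/-!
By the method of moments, it suffices to understand the moments
`(1 / N) tr ((G_w G_w^*) ^ k)` of the empirical measure.

*Loop equations.* Integration by parts for Gaussian variables (`gaussianExpectation_X_mul`), applied
to the entries of the first letter of a trace, rewrites the expectation of a product of normalised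
traces of words in the `G_i`, `G_i^*`: the trace is cut in two at an occurrence of the adjoint
letter, or, with a factor `N⁻²`, merged with another one of the traces (`loop_equation`). By
induction on the total length, the expectation of a product of normalised traces converges to the
product of the numbers `wick u` of noncrossing pairings of the words `u` that match each letter with
its adjoint (`tendsto_of_loop_equations`). Since the limit factorises, the variances of the traces
tend to `0`, and the moments converge in `L²` (`tendsto_integral_sq_moment_sub`).

*Counting pairings.* The word `(w w^*)^k` is a zigzag path between the heights `0` and `m`, where `m`
is the length of `w`. In a noncrossing pairing, the word between two matched letters contains as
many letters `G_i` as letters `G_i^*`, so matched letters are steps between the same two heights, and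
repetitions of letters in `w` do not matter. The pairing recursion therefore closes on segments of
the zigzag path, and it is solved by the coefficients of powers of the series `B = 1 + z B ^ (m + 1)`
(`raney`, `IsZigzag.wick_wordSegment_eq_raney`), which gives `FC_{m+1}(k)`.

*The limit law.* By Gauss' multiplication formula the numbers `FC_{m+1}(k)` are the moments of a
multiple of a product of independent beta variables (`exists_isFussCatalan`). They grow at most
geometrically, so by polynomial approximation on a large interval, with the tail bounded by a high
moment, finitely many moments control the integral of a bounded continuous function
(`IsFussCatalan.exists_moments_near_imp`). This gives both the uniqueness of the law and the
passage from moments to weak convergence in probability.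
-/

/-! ### Raney numbers -/

/-- The Raney number `(r / (s n + r)) * binom (s n + r) n`: the coefficient of `z ^ n` in `B ^ r`,
where `B` is the power series with `B = 1 + z * B ^ s`. The recursion compares coefficients in
`B ^ (r + 1) = B ^ r + z * B ^ (r + s)`. -/
def raney (s : ℕ) : ℕ → ℕ → ℕ
  | 0, _ => 1
  | _ + 1, 0 => 0
  | n + 1, r + 1 => raney s (n + 1) r + raney s n (r + s)

/-- `B ^ r * B ^ t = B ^ (r + t)`, coefficientwise. -/
lemma sum_raney_mul_raney (s n r t : ℕ) :
    ∑ i ∈ Finset.range (n + 1), raney s i r * raney s (n - i) t = raney s n (r + t) := by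
  induction n generalizing r t with
  | zero => simp [raney]
  | succ n ihn =>
    induction r with
    | zero => simp [Finset.sum_range_succ', raney]
    | succ r ihr =>
      rw [Finset.sum_range_succ'] at ihr ⊢
      have h : ∀ i, n + 1 - (i + 1) = n - i := fun i => by omega
      simp only [h, raney, add_mul, Finset.sum_add_distrib, ihn] at ihr ⊢
      rw [show r + 1 + t = (r + t) + 1 by ring, raney, ← ihr, show r + s + t = r + t + s by ring]
      ring

lemma raney_closed_form {s : ℕ} (hs : 0 < s) (n r : ℕ) :
    (s * n + r) * raney s n r = r * (s * n + r).choose n := by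
  induction n generalizing r with
  | zero => simp [raney]
  | succ n ihn =>
    induction r with
    | zero => simp [raney]
    | succ r ihr =>
      have h2 := ihn (r + s)
      set M := s * (n + 1) + r with hM
      have hM' : s * n + (r + s) = M := by rw [hM]; ring
      have hM1 : s * (n + 1) + (r + 1) = M + 1 := by rw [hM]; ring
      rw [hM'] at h2
      rw [hM1, raney]
      have hMpos : 0 < M := by positivity
      have hnM : n ≤ M := by nlinarith
      have e1 : (M + 1).choose (n + 1) = M.choose n + M.choose (n + 1) := Nat.choose_succ_succ _ _
      have e2 : M.choose (n + 1) * (n + 1) = M.choose n * (M - n) := Nat.choose_succ_right_eq M n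
      rw [e1]
      apply Nat.eq_of_mul_eq_mul_left hMpos
      apply Nat.eq_of_mul_eq_mul_left (Nat.succ_pos n)
      zify [hnM] at *
      linear_combination (n + 1) * (M + 1 : ℤ) * ihr + (n + 1) * (M + 1 : ℤ) * h2
        + (M + 1 : ℤ) * r * e2 - M * (r + 1 : ℤ) * e2
        - (M + 1 : ℤ) * (M.choose n : ℤ) * hM

lemma fussCatalan_eq_raney {s : ℕ} (hs : 0 < s) (n : ℕ) : fussCatalan s n = raney s n 1 := by
  have h := raney_closed_form hs n 1
  rw [fussCatalan, div_eq_iff (by positivity)]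
  have h' := congrArg (Nat.cast : ℕ → ℝ) h
  push_cast at h'
  linarith

/-! ### Words in the letters `G_i`, `G_i^*` and their noncrossing pairings -/

/-- The letter `(i, false)` stands for `G_i` and `(i, true)` for its adjoint; `letterStar` exchanges
the two. -/
def letterStar (l : ℕ × Bool) : ℕ × Bool := (l.1, !l.2)

@[simp] lemma letterStar_letterStar (l : ℕ × Bool) : letterStar (letterStar l) = l := by
  simp [letterStar]

/-- The pairs `(v₁, v₂)` with `v = v₁ ++ l :: v₂`, one for each occurrence of `l` in `v`. -/
def cuts (l : ℕ × Bool) : List (ℕ × Bool) → List (List (ℕ × Bool) × List (ℕ × Bool))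
  | [] => []
  | x :: v => (if x = l then [([], v)] else []) ++ (cuts l v).map (fun p => (x :: p.1, p.2))

lemma eq_append_of_mem_cuts {l : ℕ × Bool} {v : List (ℕ × Bool)}
    {p : List (ℕ × Bool) × List (ℕ × Bool)} (hp : p ∈ cuts l v) : v = p.1 ++ l :: p.2 := by
  induction v generalizing p with
  | nil => simp [cuts] at hp
  | cons x v ih =>
    simp only [cuts, List.mem_append, List.mem_map] at hp
    rcases hp with hp | ⟨q, hq, rfl⟩
    · split_ifs at hp with h
      · simp only [List.mem_singleton] at hp
        simp [hp, h]
      · simp at hp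
    · simp [← ih hq]

lemma length_of_mem_cuts {l : ℕ × Bool} {v : List (ℕ × Bool)}
    {p : List (ℕ × Bool) × List (ℕ × Bool)} (hp : p ∈ cuts l v) :
    p.1.length + p.2.length + 1 = v.length := by
  have h := congrArg List.length (eq_append_of_mem_cuts hp)
  simp only [List.length_append, List.length_cons] at h
  omega

/-- The number of noncrossing pairings of a word that match every letter with its adjoint: the
first letter is matched with some occurrence of its adjoint, which separates the rest of the word
into two independent words. -/
def wick : List (ℕ × Bool) → ℕ
  | [] => 1
  | l :: v => ((cuts (letterStar l) v).attach.map fun p => wick p.1.1 * wick p.1.2).sum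
termination_by v => v.length
decreasing_by
  all_goals
    have := length_of_mem_cuts p.2
    simp only [List.length_cons]
    omega

lemma wick_nil : wick [] = 1 := by rw [wick]

lemma wick_cons (l : ℕ × Bool) (v : List (ℕ × Bool)) :
    wick (l :: v) = ((cuts (letterStar l) v).map fun p => wick p.1 * wick p.2).sum := by
  rw [wick]
  exact congrArg List.sum (List.attach_map_val 
    (f := fun p : List (ℕ × Bool) × List (ℕ × Bool) => wick p.1 * wick p.2))

/-- `1` for a letter `G_i`, `-1` for a letter `G_i^*`. -/
def letterSign (l : ℕ × Bool) : ℤ := if l.2 then -1 else 1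

lemma letterSign_letterStar (l : ℕ × Bool) : letterSign (letterStar l) = -letterSign l := by
  rcases l with ⟨i, _ | _⟩ <;> simp [letterSign, letterStar]

/-- A word that admits a pairing has as many letters `G_i` as letters `G_i^*`. -/
lemma sum_letterSign_eq_zero_of_wick_ne_zero (u : List (ℕ × Bool)) (hu : wick u ≠ 0) :
    (u.map letterSign).sum = 0 := by
  induction hn : u.length using Nat.strong_induction_on generalizing u with
  | _ n ih =>
    cases u with
    | nil => simp
    | cons l v =>
      rw [wick_cons] at hu
      obtain ⟨p, hp, hne⟩ : ∃ p ∈ cuts (letterStar l) v, wick p.1 * wick p.2 ≠ 0 := by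
        by_contra! h
        refine hu (List.sum_eq_zero fun x hx => ?_)
        obtain ⟨p, hp, rfl⟩ := List.mem_map.1 hx
        exact h p hp
      have hlen := length_of_mem_cuts hp
      simp only [List.length_cons] at hn
      have h1 := ih p.1.length (by omega) p.1 (left_ne_zero_of_mul hne) rfl
      have h2 := ih p.2.length (by omega) p.2 (right_ne_zero_of_mul hne) rfl
      rw [eq_append_of_mem_cuts hp]
      simp [h1, h2, letterSign_letterStar]

/-! ### Zigzag words -/

/-- The word `c s, c (s + 1), …, c (s + n - 1)`. -/
def wordSegment (c : ℕ → ℕ × Bool) (s n : ℕ) : List (ℕ × Bool) := (List.range' s n).map c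

lemma wordSegment_succ (c : ℕ → ℕ × Bool) (s n : ℕ) :
    wordSegment c s (n + 1) = c s :: wordSegment c (s + 1) n := by
  simp [wordSegment, List.range'_succ]

lemma sum_map_cuts_wordSegment (c : ℕ → ℕ × Bool) (l : ℕ × Bool)
    (f : List (ℕ × Bool) × List (ℕ × Bool) → ℕ) (s n : ℕ) :
    ((cuts l (wordSegment c s n)).map f).sum = ∑ i ∈ Finset.range n,
      if c (s + i) = l then f (wordSegment c s i, wordSegment c (s + i + 1) (n - i - 1)) else 0 := by
  induction n generalizing s f with
  | zero => simp [wordSegment, cuts]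
  | succ n ih =>
    rw [wordSegment_succ, cuts, List.map_append, List.sum_append, List.map_map, ih,
      Finset.sum_range_succ', add_comm]
    congr 1
    · refine Finset.sum_congr rfl fun i _ => ?_
      rw [show s + 1 + i = s + (i + 1) by ring, show n + 1 - (i + 1) - 1 = n - i - 1 by omega]
      simp [wordSegment_succ]
    · simp only [add_zero]
      split_ifs <;> simp [wordSegment]

/-- A sequence of letters of period `2 m` that ascends for `m` steps and then retraces these steps
downwards: a step up is a letter `G_i`, and a step down is the adjoint of the corresponding step
up. Two positions `s`, `q` carry opposite steps between the same two heights exactly when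
`2 m ∣ s + q + 1`. -/
structure IsZigzag (m : ℕ) (c : ℕ → ℕ × Bool) : Prop where
  sign : ∀ s, letterSign (c s) = if s % (2 * m) < m then 1 else -1
  star : ∀ s q, 2 * m ∣ s + q + 1 → c q = letterStar (c s)

/-- The height after `s` steps of a path that starts at height `0` and zigzags between the heights
`0` and `m`. -/
def zigzagHeight (m s : ℕ) : ℤ := min ((s % (2 * m) : ℕ) : ℤ) (2 * m - (s % (2 * m) : ℕ))

lemma mod_two_mul_succ {m : ℕ} (hm : 0 < m) (s : ℕ) :
    ((s + 1) % (2 * m) = s % (2 * m) + 1 ∧ s % (2 * m) + 1 < 2 * m) ∨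
      ((s + 1) % (2 * m) = 0 ∧ s % (2 * m) + 1 = 2 * m) := by
  have h1 := Nat.mod_lt s (show 0 < 2 * m by omega)
  rw [Nat.add_mod s 1]
  rcases Nat.lt_or_ge (s % (2 * m) + 1) (2 * m) with h | h
  · left
    rw [Nat.mod_eq_of_lt (show 1 < 2 * m by omega), Nat.mod_eq_of_lt h]
    exact ⟨rfl, h⟩
  · right
    have : s % (2 * m) + 1 = 2 * m := by omega
    rw [Nat.mod_eq_of_lt (show 1 < 2 * m by omega), this]
    simp

namespace IsZigzag

variable {m : ℕ} {c : ℕ → ℕ × Bool}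

lemma sum_letterSign_wordSegment (hc : IsZigzag m c) (hm : 0 < m) (s n : ℕ) :
    ((wordSegment c s n).map letterSign).sum = zigzagHeight m (s + n) - zigzagHeight m s := by
  induction n generalizing s with
  | zero => simp [wordSegment]
  | succ n ih =>
    rw [wordSegment_succ, List.map_cons, List.sum_cons, ih, hc.sign, show s + 1 + n = s + (n + 1) by ring]
    have h : zigzagHeight m (s + 1) = zigzagHeight m s + if s % (2 * m) < m then 1 else -1 := by
      unfold zigzagHeight
      rcases mod_two_mul_succ hm s with ⟨h1, h2⟩ | ⟨h1, h2⟩ <;> rw [h1] <;> split_ifs <;> omega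
    rw [h]
    ring

/-- If the letter at `q` can be matched with the letter at `s` in a noncrossing pairing, then the
word between them returns to its initial height, so that the two letters are steps between the
same two heights. -/
lemma dvd_of_wick_ne_zero (hc : IsZigzag m c) (hm : 0 < m) {s p : ℕ}
    (hp : wick (wordSegment c (s + 1) p) ≠ 0) (hq : c (s + 1 + p) = letterStar (c s)) :
    2 * m ∣ s + (s + 1 + p) + 1 := by
  have h1 := sum_letterSign_eq_zero_of_wick_ne_zero _ hp
  rw [hc.sum_letterSign_wordSegment hm] at h1
  have h2 := congrArg letterSign hq
  rw [letterSign_letterStar, hc.sign, hc.sign] at h2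
  have key : s % (2 * m) + (s + 1 + p) % (2 * m) + 1 = 2 * m := by
    have h3 := Nat.mod_lt (s + 1 + p) (show 0 < 2 * m by omega)
    unfold zigzagHeight at h1
    rcases mod_two_mul_succ hm s with ⟨h4, h5⟩ | ⟨h4, h5⟩ <;> rw [h4] at h1 <;>
      split_ifs at h2 <;> omega
  have h6 := Nat.div_add_mod s (2 * m)
  have h7 := Nat.div_add_mod (s + 1 + p) (2 * m)
  refine ⟨s / (2 * m) + (s + 1 + p) / (2 * m) + 1, ?_⟩
  rw [mul_add, mul_add, mul_one]
  omega

/-- The pairing recursion on a zigzag word. The letter at `s`, from which the path moves in the same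
direction for `d` steps until it turns, can only be matched with the letters at
`s + 2 d - 1 + 2 m i`. -/
lemma wick_wordSegment (hc : IsZigzag m c) (hm : 0 < m) {s d n K : ℕ} (hd : 0 < d) (hdm : d ≤ m)
    (hsd : m ∣ s + d) (hn : 0 < n) (hK : ∀ i, i < K ↔ 2 * d + 2 * m * i ≤ n) :
    wick (wordSegment c s n) = ∑ i ∈ Finset.range K,
      wick (wordSegment c (s + 1) (2 * (d - 1) + 2 * m * i)) *
        wick (wordSegment c (s + 2 * d + 2 * m * i) (n - 2 * d - 2 * m * i)) := by
  obtain ⟨n, rfl⟩ := Nat.exists_eq_succ_of_ne_zero hn.ne'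
  rw [wordSegment_succ, wick_cons, sum_map_cuts_wordSegment]
  symm
  refine Finset.sum_of_injOn (fun i => 2 * (d - 1) + 2 * m * i) ?_ ?_ ?_ ?_
  · intro i _ j _ hij
    simpa [hm.ne'] using hij
  · intro i hi
    simp only [Finset.coe_range, Set.mem_Iio] at hi ⊢
    have := (hK i).1 hi
    omega
  · intro p hp hp'
    split_ifs with h
    · by_contra hne
      have hdvd := hc.dvd_of_wick_ne_zero hm (left_ne_zero_of_mul hne) h
      apply hp'
      obtain ⟨a, ha⟩ := hsd
      obtain ⟨b, hb⟩ := hdvd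
      -- `p = 2 (d - 1) + 2 m (b - a)`
      have hab : a ≤ b := by
        by_contra! hlt
        have h1 : b + 1 ≤ a := hlt
        have h2 := Nat.mul_le_mul_left (2 * m) h1
        have h3 : 2 * m * a = 2 * (s + d) := by rw [ha]; ring
        rw [mul_add] at h2
        omega
      obtain ⟨e, rfl⟩ := Nat.exists_eq_add_of_le hab
      have h3 : 2 * m * a = 2 * (s + d) := by rw [ha]; ring
      rw [mul_add] at hb
      have hp2 : p < n := by simpa using hp
      refine ⟨e, ?_, ?_⟩
      · simp only [Finset.coe_range, Set.mem_Iio, hK]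
        omega
      · simp only
        omega
    · rfl
  · intro i hi
    have hi' := (hK i).1 (by simpa using hi)
    have hdvd : 2 * m ∣ s + (s + 1 + (2 * (d - 1) + 2 * m * i)) + 1 := by
      obtain ⟨a, ha⟩ := hsd
      refine ⟨a + i, ?_⟩
      have h3 : 2 * m * a = 2 * (s + d) := by rw [ha]; ring
      rw [mul_add]
      omega
    rw [if_pos (hc.star _ _ hdvd)]
    simp only
    rw [show s + 1 + (2 * (d - 1) + 2 * m * i) + 1 = s + 2 * d + 2 * m * i by omega,
      show n - (2 * (d - 1) + 2 * m * i) - 1 = n + 1 - 2 * d - 2 * m * i by omega]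

/-- The number of pairings of a zigzag word that starts and ends at the same height is a Raney
number that depends only on the length of the word. Such a word either consists of full periods
(first part), or it consists of full periods and a piece in which the path runs `d` steps to its
next turning point and back (second part); the two forms occur together in the recursion. -/
lemma wick_wordSegment_eq_raney (hc : IsZigzag m c) (hm : 0 < m) (n : ℕ) :
    (∀ s k, n = 2 * m * k → wick (wordSegment c s n) = raney (m + 1) k 1) ∧
    (∀ s d k, d ≤ m → m ∣ s + d → n = 2 * d + 2 * m * k →
      wick (wordSegment c s n) = raney (m + 1) k (d + 1)) := by
  induction n using Nat.strong_induction_on with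
  | _ n ih =>
    have first : ∀ s k, n = 2 * m * k → wick (wordSegment c s n) = raney (m + 1) k 1 := by
      intro s k hn
      rcases k with _ | k
      · subst hn
        simp [wordSegment, wick_nil, raney]
      · obtain ⟨d, hd, hdm, hsd⟩ : ∃ d, 0 < d ∧ d ≤ m ∧ m ∣ s + d := by
          have h1 := Nat.mod_lt s hm
          refine ⟨m - s % m, by omega, by omega, s / m + 1, ?_⟩
          have := Nat.div_add_mod s m
          rw [mul_add]
          omega
        have hexp : 2 * m * (k + 1) = 2 * m * k + 2 * m := by ring
        rw [hc.wick_wordSegment hm hd hdm hsd (K := k + 1) (by rw [hn]; positivity)]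
        -- `B ^ d * B ^ (m - d + 1) = B ^ (m + 1)`, and `z * B ^ (m + 1) = B - 1`
        · have hconv := sum_raney_mul_raney (m + 1) k d (m - d + 1)
          rw [show d + (m - d + 1) = 0 + (m + 1) by omega] at hconv
          rw [show raney (m + 1) (k + 1) 1 = raney (m + 1) k (0 + (m + 1)) by simp [raney], ← hconv]
          refine Finset.sum_congr rfl fun i hi => ?_
          have hik : i ≤ k := by simpa [Nat.lt_succ_iff] using hi
          obtain ⟨e, rfl⟩ := Nat.exists_eq_add_of_le hik
          have hexp2 : 2 * m * (i + e) = 2 * m * i + 2 * m * e := by ring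
          obtain ⟨a, ha⟩ := hsd
          congr 1
          · rw [(ih _ (by omega)).2 (s + 1) (d - 1) i (by omega) ⟨a, by omega⟩ rfl,
              show d - 1 + 1 = d by omega]
          · refine (ih _ (by omega)).2 _ (m - d) _ (by omega) ⟨a + 2 * i + 1, ?_⟩ ?_
            · have : m * (a + 2 * i + 1) = m * a + 2 * m * i + m := by ring
              omega
            · rw [show i + e - i = e by omega]
              omega
        · intro i
          constructor
          · intro hi
            have := Nat.mul_le_mul_left (2 * m) (show i ≤ k by omega)
            omega
          · intro hi
            by_contra! hlt
            have := Nat.mul_le_mul_left (2 * m) hlt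
            omega
    -- `B ^ d * B = B ^ (d + 1)`
    refine ⟨first, fun s d k hdm hsd hn => ?_⟩
    rcases Nat.eq_zero_or_pos d with rfl | hd
    · exact first s k (by omega)
    · rw [hc.wick_wordSegment hm hd hdm hsd (K := k + 1) (by omega)]
      · rw [← sum_raney_mul_raney (m + 1) k d 1]
        refine Finset.sum_congr rfl fun i hi => ?_
        have hik : i ≤ k := by simpa [Nat.lt_succ_iff] using hi
        obtain ⟨e, rfl⟩ := Nat.exists_eq_add_of_le hik
        have hexp2 : 2 * m * (i + e) = 2 * m * i + 2 * m * e := by ring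
        obtain ⟨a, ha⟩ := hsd
        congr 1
        · rw [(ih _ (by omega)).2 (s + 1) (d - 1) i (by omega) ⟨a, by omega⟩ rfl,
            show d - 1 + 1 = d by omega]
        · refine (ih _ (by omega)).1 _ _ ?_
          rw [show i + e - i = e by omega]
          omega
      · intro i
        constructor
        · intro hi
          have := Nat.mul_le_mul_left (2 * m) (show i ≤ k by omega)
          omega
        · intro hi
          by_contra! hlt
          have := Nat.mul_le_mul_left (2 * m) hlt
          rw [mul_add] at this
          omega

end IsZigzag

/-- The word of `G_w`. -/
def plainWord (w : List ℕ) : List (ℕ × Bool) := w.map fun i => (i, false)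

/-- The word of the adjoint of `G_w`. -/
def adjointWord (w : List ℕ) : List (ℕ × Bool) := (w.map fun i => (i, true)).reverse

/-- The `k`-th power of the word of `G_w G_w^*`. -/
def powerWord (w : List ℕ) (k : ℕ) : List (ℕ × Bool) :=
  (List.replicate k (plainWord w ++ adjointWord w)).flatten

lemma wick_powerWord (w : List ℕ) (k : ℕ) : wick (powerWord w k) = raney (w.length + 1) k 1 := by
  rcases Nat.eq_zero_or_pos w.length with h0 | hm
  · obtain rfl : w = [] := List.length_eq_zero_iff.1 h0
    have h : powerWord [] k = [] := by simp [powerWord, plainWord, adjointWord]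
    have hr : ∀ n, raney 1 n 1 = 1 := by
      intro n
      induction n with
      | zero => simp [raney]
      | succ n ih => simp [raney, ih]
    simp [h, wick_nil, hr]
  · set m := w.length with hm_def
    set W := plainWord w ++ adjointWord w with hW
    have hWlen : W.length = 2 * m := by simp [hW, plainWord, adjointWord]; omega
    have hmod : ∀ s, s % (2 * m) < 2 * m := fun s => Nat.mod_lt _ (by omega)
    have get1 : ∀ i (hi : i < m), W.getD i (0, false) = (w[i], false) := by
      intro i hi
      simp [hW, plainWord, adjointWord, List.getD_eq_getElem?_getD, List.getElem?_append, ← hm_def, hi]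
    have get2 : ∀ i (hi : i < m), W.getD (2 * m - 1 - i) (0, false) = (w[i], true) := by
      intro i hi
      have h1 : ¬ (2 * m - 1 - i < m) := by omega
      have h2 : m - 1 - (2 * m - 1 - i - m) = i := by omega
      have h3 : 2 * m - 1 - i - m < m := by omega
      simp [hW, plainWord, adjointWord, List.getD_eq_getElem?_getD, List.getElem?_append, ← hm_def,
        h1, h2, h3]
    set c : ℕ → ℕ × Bool := fun s => W.getD (s % (2 * m)) (0, false) with hc_def
    have hc : IsZigzag m c := by
      constructor
      · intro s
        simp only [hc_def]
        split_ifs with h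
        · rw [get1 _ h]
          rfl
        · have := hmod s
          rw [show s % (2 * m) = 2 * m - 1 - (2 * m - 1 - s % (2 * m)) by omega,
            get2 _ (by omega)]
          rfl
      · intro s q hsq
        have h1 := hmod s
        have h2 := hmod q
        have key : q % (2 * m) = 2 * m - 1 - s % (2 * m) := by
          have h3 : 2 * m ∣ s % (2 * m) + q % (2 * m) + 1 := by
            rw [Nat.dvd_iff_mod_eq_zero] at hsq ⊢
            rw [← hsq]
            simp [Nat.add_mod]
          obtain ⟨t, ht⟩ := h3
          have ht1 : t = 1 := by
            rcases t with _ | _ | t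
            · omega
            · rfl
            · have : 2 * m * (t + 1 + 1) = 2 * m * t + 4 * m := by ring
              omega
          subst ht1
          omega
        simp only [hc_def, key]
        rcases Nat.lt_or_ge (s % (2 * m)) m with h | h
        · rw [get1 _ h, get2 _ h]
          rfl
        · have h4 : 2 * m - 1 - s % (2 * m) < m := by omega
          rw [get1 _ h4]
          have h5 := get2 _ h4
          rw [show 2 * m - 1 - (2 * m - 1 - s % (2 * m)) = s % (2 * m) by omega] at h5
          rw [h5]
          rfl
    have hseg : powerWord w k = wordSegment c 0 (2 * m * k) := by
      induction k with
      | zero => simp [powerWord, wordSegment]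
      | succ k ih =>
        have hper : wordSegment c (2 * m * k) (2 * m) = W := by
          apply List.ext_getElem
          · simp [wordSegment, hWlen]
          · intro i h1 h2
            have hi : i < 2 * m := by omega
            simp [wordSegment, hc_def, Nat.mod_eq_of_lt hi, List.getD_eq_getElem?_getD, h2]
        have hsplit : wordSegment c 0 (2 * m * (k + 1)) =
            wordSegment c 0 (2 * m * k) ++ wordSegment c (2 * m * k) (2 * m) := by
          rw [wordSegment, wordSegment, wordSegment, ← List.map_append, mul_add, mul_one]
          congr 1
          rw [← List.range'_append]
          simp
        rw [hsplit, ← ih, hper]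
        simp [powerWord, List.replicate_succ', hW]
    rw [hseg]
    exact (hc.wick_wordSegment_eq_raney hm _).1 0 k rfl

/-! ### Existence of the Fuss-Catalan distribution -/

/-- `u` is the moment sequence of a probability measure on `[0, ∞)`. -/
def IsMomentSeq (u : ℕ → ℝ≥0) : Prop :=
  ∃ ρ : Measure ℝ≥0, IsProbabilityMeasure ρ ∧ ∀ k, ∫⁻ x, (x : ℝ≥0∞) ^ k ∂ρ = u k

lemma isMomentSeq_pow (c : ℝ≥0) : IsMomentSeq fun k => c ^ k :=
  ⟨Measure.dirac c, inferInstance, fun k => by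
    rw [lintegral_dirac' _ (by fun_prop)]
    simp⟩

/-- Moment sequences multiply under the product of independent variables. -/
lemma IsMomentSeq.mul {u v : ℕ → ℝ≥0} (hu : IsMomentSeq u) (hv : IsMomentSeq v) :
    IsMomentSeq fun k => u k * v k := by
  obtain ⟨μ, hμ, hμu⟩ := hu
  obtain ⟨ν, hν, hνv⟩ := hv
  refine ⟨(μ.prod ν).map fun p => p.1 * p.2,
    Measure.isProbabilityMeasure_map (by fun_prop), fun k => ?_⟩
  rw [lintegral_map (by fun_prop) (by fun_prop)]
  simp only [ENNReal.coe_mul, mul_pow]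
  rw [lintegral_prod_mul (f := fun x : ℝ≥0 => (x : ℝ≥0∞) ^ k) (g := fun x : ℝ≥0 => (x : ℝ≥0∞) ^ k)
    (by fun_prop) (by fun_prop), hμu, hνv]

lemma IsMomentSeq.prod {ι : Type*} (s : Finset ι) {u : ι → ℕ → ℝ≥0}
    (h : ∀ i ∈ s, IsMomentSeq (u i)) : IsMomentSeq fun k => ∏ i ∈ s, u i k := by
  classical
  induction s using Finset.induction_on with
  | empty => simpa using isMomentSeq_pow 1
  | insert i s hi ih =>
    simp only [Finset.prod_insert hi]
    exact (h i (by simp)).mul (ih fun j hj => h j (by simp [hj]))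

lemma mul_betaPDF {α β : ℝ} (hα : 0 < α) (hβ : 0 < β) (x : ℝ) :
    ENNReal.ofReal x * betaPDF α β x =
      ENNReal.ofReal (α / (α + β)) * betaPDF (α + 1) β x := by
  rcases le_or_gt x 0 with hx | hx
  · rw [betaPDF_eq_zero_of_nonpos hx, betaPDF_eq_zero_of_nonpos hx]
    simp
  rcases le_or_gt 1 x with hx1 | hx1
  · rw [betaPDF_eq_zero_of_one_le hx1, betaPDF_eq_zero_of_one_le hx1]
    simp
  rw [betaPDF_of_pos_lt_one hx hx1, betaPDF_of_pos_lt_one hx hx1, ← ENNReal.ofReal_mul hx.le,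
    ← ENNReal.ofReal_mul (by positivity)]
  congr 1
  have hb : beta (α + 1) β = beta α β * (α / (α + β)) := by
    have h1 := (Real.Gamma_pos_of_pos (add_pos hα hβ)).ne'
    have h2 := (add_pos hα hβ).ne'
    rw [beta, beta, Real.Gamma_add_one hα.ne', show α + 1 + β = α + β + 1 by ring,
      Real.Gamma_add_one h2]
    field_simp
  have h3 := (beta_pos hα hβ).ne'
  have h2 := (add_pos hα hβ).ne'
  rw [hb, show x ^ (α + 1 - 1) = x * x ^ (α - 1) by
    rw [show α + 1 - 1 = 1 + (α - 1) by ring, Real.rpow_add hx, Real.rpow_one]]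
  field_simp

lemma lintegral_pow_mul_betaPDF {α β : ℝ} (hα : 0 < α) (hβ : 0 < β) (k : ℕ) :
    ∫⁻ x, ENNReal.ofReal x ^ k * betaPDF α β x =
      ENNReal.ofReal (∏ i ∈ Finset.range k, (α + i) / (α + β + i)) := by
  induction k generalizing α with
  | zero => simp [hα, hβ]
  | succ k ih =>
    have hmeas : Measurable (betaPDF (α + 1) β) := by
      unfold betaPDF
      fun_prop
    simp_rw [pow_succ, mul_assoc, mul_betaPDF hα hβ]
    simp_rw [mul_left_comm _ (ENNReal.ofReal (α / (α + β)))]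
    rw [lintegral_const_mul _ (by fun_prop), ih (by positivity),
      ← ENNReal.ofReal_mul (by positivity), Finset.prod_range_succ']
    congr 1
    push_cast
    rw [mul_comm, add_zero, add_zero]
    congr 1
    refine Finset.prod_congr rfl fun i _ => ?_
    ring_nf

/-- The moment sequence of the beta distribution with parameters `a`, `b - a`. -/
lemma isMomentSeq_beta {a b : ℝ≥0} (ha : 0 < a) (hab : a < b) :
    IsMomentSeq fun k => ∏ i ∈ Finset.range k, (a + i) / (b + i) := by
  have hα : 0 < (a : ℝ) := ha
  have hβ : 0 < (b : ℝ) - a := sub_pos.2 hab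
  have hprob := isProbabilityMeasureBeta hα hβ
  refine ⟨(betaMeasure a (b - a)).map Real.toNNReal,
    Measure.isProbabilityMeasure_map (by fun_prop), fun k => ?_⟩
  have hmeas : Measurable (betaPDF a (b - a)) := by
    unfold betaPDF
    fun_prop
  rw [lintegral_map (by fun_prop) (by fun_prop), betaMeasure,
    lintegral_withDensity_eq_lintegral_mul _ hmeas (by fun_prop)]
  simp only [Pi.mul_apply, mul_comm (betaPDF _ _ _)]
  refine (lintegral_pow_mul_betaPDF hα hβ k).trans ?_
  rw [← ENNReal.ofReal_coe_nnreal]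
  congr 1
  push_cast
  simp

lemma fussCatalan_eq_factorial (t k : ℕ) :
    fussCatalan (t + 1) k = (((t + 1) * k).factorial : ℝ) / (k.factorial * (t * k + 1).factorial) := by
  have hsub : (t + 1) * k + 1 - k = t * k + 1 := by
    rw [add_mul, one_mul]
    omega
  have hle : k ≤ (t + 1) * k + 1 := by nlinarith
  rw [fussCatalan, Nat.cast_choose ℝ hle, hsub, Nat.factorial_succ]
  push_cast
  have : ((t : ℝ) + 1) * k + 1 ≠ 0 := by positivity
  field_simp

/-- Fuss-Catalan numbers are, up to a geometric factor, products of moments of beta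
distributions (this is Gauss' multiplication formula). -/
lemma fussCatalan_eq_prod (t k : ℕ) :
    fussCatalan (t + 1) k = (((t : ℝ) + 1) ^ (t + 1) / (t : ℝ) ^ t) ^ k *
      ∏ j ∈ Finset.range t, ∏ i ∈ Finset.range k,
        (((j : ℝ) + 1) / (t + 1) + i) / (((j : ℝ) + 2) / t + i) := by
  induction k with
  | zero => simp [fussCatalan]
  | succ k ih =>
    have hratio : fussCatalan (t + 1) (k + 1) = fussCatalan (t + 1) k *
        ((t + 1) * ∏ j ∈ Finset.range t, (((t : ℝ) + 1) * k + 1 + j) / (t * k + 2 + j)) := by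
      have h1 := Nat.factorial_mul_ascFactorial ((t + 1) * k) (t + 1)
      have h2 := Nat.factorial_mul_ascFactorial (t * k + 1) t
      rw [Nat.ascFactorial_eq_prod_range] at h1 h2
      rw [Finset.prod_range_succ] at h1
      rw [fussCatalan_eq_factorial, fussCatalan_eq_factorial,
        show (t + 1) * (k + 1) = (t + 1) * k + (t + 1) by ring,
        show t * (k + 1) + 1 = t * k + 1 + t by ring, ← h1, ← h2, Nat.factorial_succ,
        Finset.prod_div_distrib]
      push_cast
      have e1 : ∏ x ∈ Finset.range t, ((t : ℝ) * k + 1 + 1 + x)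
          = ∏ x ∈ Finset.range t, ((t : ℝ) * k + 2 + x) :=
        Finset.prod_congr rfl fun x _ => by ring
      have e2 : ∏ x ∈ Finset.range t, ((t : ℝ) * k + 2 + x) ≠ 0 :=
        Finset.prod_ne_zero_iff.2 fun x _ => by positivity
      rw [e1]
      have e3 : ((t : ℝ) + 1) * k + 1 + t = (t + 1) * (k + 1) := by ring
      rw [e3]
      field_simp
    rw [hratio, ih, pow_succ]
    simp only [Finset.prod_range_succ, Finset.prod_mul_distrib]
    rcases Nat.eq_zero_or_pos t with rfl | ht
    · simp
    have ht' : (t : ℝ) ≠ 0 := by positivity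
    have e : ∏ j ∈ Finset.range t, (((j : ℝ) + 1) / (t + 1) + k) / (((j : ℝ) + 2) / t + k) =
        ((t : ℝ) / (t + 1)) ^ t *
          ∏ j ∈ Finset.range t, (((t : ℝ) + 1) * k + 1 + j) / (t * k + 2 + j) := by
      rw [← Finset.card_range t, ← Finset.prod_const, Finset.card_range, ← Finset.prod_mul_distrib]
      refine Finset.prod_congr rfl fun j _ => ?_
      have h1 : (t : ℝ) * k + 2 + j ≠ 0 := by positivity
      have h2 : (j : ℝ) + 2 + t * k ≠ 0 := by positivity
      field_simp
      ring
    have hK : ((t : ℝ) + 1) ^ (t + 1) / (t : ℝ) ^ t * ((t : ℝ) / (t + 1)) ^ t = t + 1 := by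
      rw [div_pow, pow_succ]
      field_simp
    rw [e]
    set K := ((t : ℝ) + 1) ^ (t + 1) / (t : ℝ) ^ t
    set A := ∏ j ∈ Finset.range t, ∏ i ∈ Finset.range k,
      (((j : ℝ) + 1) / (t + 1) + i) / (((j : ℝ) + 2) / t + i)
    set Q := ∏ j ∈ Finset.range t, (((t : ℝ) + 1) * k + 1 + j) / (t * k + 2 + j)
    linear_combination -(K ^ k * A * Q) * hK

lemma exists_isFussCatalan (t : ℕ) : ∃ ρ : Measure ℝ, IsFussCatalan (t + 1) ρ := by
  have hseq : IsMomentSeq fun k => (((t : ℝ≥0) + 1) ^ (t + 1) / (t : ℝ≥0) ^ t) ^ k *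
      ∏ j ∈ Finset.range t, ∏ i ∈ Finset.range k,
        (((j : ℝ≥0) + 1) / (t + 1) + i) / (((j : ℝ≥0) + 2) / t + i) := by
    refine (isMomentSeq_pow _).mul (IsMomentSeq.prod _ fun j hj => isMomentSeq_beta (by positivity) ?_)
    have ht : (0 : ℝ≥0) < t := by
      have : 0 < t := by
        have := Finset.mem_range.1 hj
        omega
      positivity
    rw [div_lt_div_iff₀ (by positivity) ht]
    calc ((j : ℝ≥0) + 1) * t < ((j : ℝ≥0) + 1) * t + (t + j + 2) :=
          lt_add_of_pos_right _ (by positivity)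
      _ = ((j : ℝ≥0) + 2) * (t + 1) := by ring
  obtain ⟨ρ, hρ, hmom⟩ := hseq
  have hmom' : ∀ k, ∫⁻ x, (x : ℝ≥0∞) ^ k ∂ρ = ENNReal.ofReal (fussCatalan (t + 1) k) := by
    intro k
    rw [hmom, fussCatalan_eq_prod, ← ENNReal.ofReal_coe_nnreal]
    push_cast
    rfl
  have hpow : ∀ (k : ℕ) (x : ℝ≥0), ENNReal.ofReal ((x : ℝ) ^ k) = (x : ℝ≥0∞) ^ k := by
    intro k x
    rw [← NNReal.coe_pow, ENNReal.ofReal_coe_nnreal, ENNReal.coe_pow]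
  have hnn : ∀ k, 0 ≤ fussCatalan (t + 1) k := fun k => by
    unfold fussCatalan
    positivity
  have hint : ∀ k : ℕ, Integrable (fun x : ℝ≥0 => (x : ℝ) ^ k) ρ := by
    intro k
    refine ⟨by fun_prop, ?_⟩
    rw [hasFiniteIntegral_iff_ofReal (ae_of_all _ fun x => by positivity)]
    simp only [hpow, hmom']
    exact ENNReal.ofReal_lt_top
  have hemb : Measurable (fun x : ℝ≥0 => (x : ℝ)) := by fun_prop
  refine ⟨ρ.map fun x : ℝ≥0 => (x : ℝ), Measure.isProbabilityMeasure_map hemb.aemeasurable, ?_, ?_, ?_⟩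
  · rw [Measure.map_apply hemb measurableSet_Iio]
    convert measure_empty (μ := ρ)
    ext x
    simp
  · intro k
    rw [integrable_map_measure (by fun_prop) hemb.aemeasurable]
    exact hint k
  · intro k
    rw [integral_map hemb.aemeasurable (by fun_prop),
      integral_eq_lintegral_of_nonneg_ae (ae_of_all _ fun x => by positivity) (hint k).1]
    simp only [hpow, hmom']
    exact ENNReal.toReal_ofReal (hnn k)

/-! ### Moments and weak convergence -/

/-- `ν` is a probability measure on `[0, ∞)` all of whose moments are finite. -/
structure HasFiniteMoments (ν : Measure ℝ) : Prop where
  isProbabilityMeasure : IsProbabilityMeasure ν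
  nonneg : ν (Set.Iio 0) = 0
  integrable_pow : ∀ k : ℕ, Integrable (fun x : ℝ => x ^ k) ν

lemma IsFussCatalan.hasFiniteMoments {s : ℕ} {ρ : Measure ℝ} (h : IsFussCatalan s ρ) :
    HasFiniteMoments ρ :=
  ⟨h.isProbabilityMeasure, h.nonneg, h.integrable_pow⟩

lemma abs_polynomial_eval_le {p : Polynomial ℝ} {x : ℝ} (hx : 1 ≤ x) :
    |p.eval x| ≤ (∑ k ∈ Finset.range (p.natDegree + 1), |p.coeff k|) * x ^ p.natDegree := by
  rw [Polynomial.eval_eq_sum_range, Finset.sum_mul]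
  refine (Finset.abs_sum_le_sum_abs _ _).trans (Finset.sum_le_sum fun k hk => ?_)
  rw [abs_mul, abs_of_nonneg (pow_nonneg (zero_le_one.trans hx) k)]
  exact mul_le_mul_of_nonneg_left
    (pow_le_pow_right₀ hx (Nat.lt_succ_iff.1 (Finset.mem_range.1 hk))) (abs_nonneg _)

/-- If the numbers `u k` grow at most geometrically, then for every bounded continuous `f` there is
a number `L`, independent of `ν`, that is close to `∫ f dν` as soon as finitely many moments of `ν` are close to those of
`u`: approximate `f` by a polynomial on a large interval `[0, K + 1]`, and bound the rest by a high
moment. -/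
lemma exists_integral_near_of_moments_near {u : ℕ → ℝ} {C K : ℝ} (hK : 1 ≤ K)
    (hu : ∀ k, |u k| ≤ C * K ^ k) (f : ℝ →ᵇ ℝ) {ε : ℝ} (hε : 0 < ε) :
    ∃ (L : ℝ) (D : ℕ) (η : ℝ), 0 < η ∧ ∀ ν : Measure ℝ, HasFiniteMoments ν →
      (∀ k ≤ D, |∫ x, x ^ k ∂ν - u k| ≤ η) → |∫ x, f x ∂ν - L| ≤ ε := by
  have hC : 0 ≤ C := by simpa using (abs_nonneg _).trans (hu 0)
  obtain ⟨p, hp⟩ := exists_polynomial_near_of_continuousOn 0 (K + 1) f f.continuous.continuousOn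
    (ε / 3) (by positivity)
  set d := p.natDegree with hd
  set S := ∑ k ∈ Finset.range (d + 1), |p.coeff k| with hS
  have hS0 : 0 ≤ S := Finset.sum_nonneg fun k _ => abs_nonneg _
  set c := ‖f‖ + S with hc
  have hc0 : 0 ≤ c := by positivity
  have hA : 0 < K + 1 := by linarith
  -- the contribution of `x > K + 1` is controlled by the moment of order `d + j`
  obtain ⟨j, hj⟩ : ∃ j : ℕ, c * (C * K ^ d) * (K / (K + 1)) ^ j ≤ ε / 3 := by
    have hlim : Tendsto (fun j : ℕ => c * (C * K ^ d) * (K / (K + 1)) ^ j) atTop (𝓝 0) := by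
      have := tendsto_pow_atTop_nhds_zero_of_lt_one (r := K / (K + 1)) (by positivity)
        ((div_lt_one hA).2 (by linarith))
      simpa using this.const_mul (c * (C * K ^ d))
    exact (hlim.eventually (ge_mem_nhds (by positivity : (0 : ℝ) < ε / 3))).exists
  -- `L` is the value at `p` of the linear functional with moments `u`
  refine ⟨∑ k ∈ Finset.range (d + 1), p.coeff k * u k, d + j, ε / (3 * (c + S + 1)),
    by positivity, fun ν hν hmom => ?_⟩
  set η := ε / (3 * (c + S + 1)) with hη
  have hη0 : 0 ≤ η := by positivity
  have := hν.isProbabilityMeasure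
  have hpint : ∀ k ∈ Finset.range (d + 1), Integrable (fun x : ℝ => p.coeff k * x ^ k) ν :=
    fun k _ => (hν.integrable_pow k).const_mul _
  have hpeval : (fun x => p.eval x) = fun x => ∑ k ∈ Finset.range (d + 1), p.coeff k * x ^ k := by
    ext x
    rw [Polynomial.eval_eq_sum_range]
  have hpI : Integrable (fun x => p.eval x) ν := by
    rw [hpeval]
    exact integrable_finsetSum _ hpint
  have hfI : Integrable (fun x => f x) ν := f.integrable ν
  have hpv : ∫ x, p.eval x ∂ν = ∑ k ∈ Finset.range (d + 1), p.coeff k * ∫ x, x ^ k ∂ν := by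
    rw [hpeval, integral_finsetSum _ hpint]
    simp only [integral_const_mul]
  have h1 : |∫ x, p.eval x ∂ν - ∑ k ∈ Finset.range (d + 1), p.coeff k * u k| ≤ S * η := by
    rw [hpv, ← Finset.sum_sub_distrib, hS, Finset.sum_mul]
    refine (Finset.abs_sum_le_sum_abs _ _).trans (Finset.sum_le_sum fun k hk => ?_)
    rw [← mul_sub, abs_mul]
    refine mul_le_mul_of_nonneg_left (hmom k ?_) (abs_nonneg _)
    have := Finset.mem_range.1 hk
    omega
  have hpt : ∀ x : ℝ, 0 ≤ x → |f x - p.eval x| ≤ ε / 3 + c / (K + 1) ^ j * x ^ (d + j) := by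
    intro x hx
    rcases le_or_gt x (K + 1) with hxA | hxA
    · have h2 := (hp x ⟨hx, hxA⟩).le
      rw [abs_sub_comm] at h2
      have : 0 ≤ c / (K + 1) ^ j * x ^ (d + j) := by positivity
      linarith
    · have hx1 : 1 ≤ x := by linarith
      have h2 : |f x - p.eval x| ≤ c * x ^ d := by
        have h3 : |f x| ≤ ‖f‖ := f.norm_coe_le_norm x
        have h4 := abs_polynomial_eval_le (p := p) hx1
        have h5 : 1 ≤ x ^ d := one_le_pow₀ hx1
        calc |f x - p.eval x| ≤ |f x| + |p.eval x| := abs_sub _ _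
          _ ≤ ‖f‖ * x ^ d + S * x ^ d :=
            add_le_add (h3.trans (le_mul_of_one_le_right (norm_nonneg _) h5)) h4
          _ = c * x ^ d := by rw [hc]; ring
      have h6 : (K + 1) ^ j ≤ x ^ j := pow_le_pow_left₀ hA.le hxA.le j
      have h7 : c * x ^ d ≤ c / (K + 1) ^ j * x ^ (d + j) := by
        rw [pow_add, div_mul_eq_mul_div, le_div_iff₀ (by positivity), ← mul_assoc]
        exact mul_le_mul_of_nonneg_left h6 (by positivity)
      linarith
  have h8 : |∫ x, f x ∂ν - ∫ x, p.eval x ∂ν| ≤ ε / 3 + (ε / 3 + c * η) := by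
    rw [← integral_sub hfI hpI]
    have hnn : ∀ᵐ x ∂ν, 0 ≤ x := by
      rw [ae_iff]
      simpa [Set.Iio] using hν.nonneg
    calc |∫ x, f x - p.eval x ∂ν| ≤ ∫ x, |f x - p.eval x| ∂ν := abs_integral_le_integral_abs
      _ ≤ ∫ x, (ε / 3 + c / (K + 1) ^ j * x ^ (d + j)) ∂ν := by
        refine integral_mono_ae (hfI.sub hpI).abs
          ((integrable_const _).add ((hν.integrable_pow _).const_mul _)) ?_
        filter_upwards [hnn] with x hx using hpt x hx
      _ = ε / 3 + c / (K + 1) ^ j * ∫ x, x ^ (d + j) ∂ν := by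
        rw [integral_add (integrable_const _) ((hν.integrable_pow _).const_mul _),
          integral_const_mul]
        simp
      _ ≤ ε / 3 + c / (K + 1) ^ j * (C * K ^ (d + j) + η) := by
        have h9 := (abs_le.1 (hmom (d + j) le_rfl)).2
        have h10 := (abs_le.1 (hu (d + j))).2
        gcongr
        linarith
      _ ≤ ε / 3 + (ε / 3 + c * η) := by
        have h11 : c / (K + 1) ^ j * (C * K ^ (d + j)) = c * (C * K ^ d) * (K / (K + 1)) ^ j := by
          rw [div_pow, pow_add]
          field_simp
        have h12 : c / (K + 1) ^ j ≤ c := div_le_self hc0 (one_le_pow₀ (by linarith))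
        rw [mul_add, h11]
        gcongr
  have h13 : (c + S) * η ≤ ε / 3 := by
    rw [hη, mul_div_assoc', div_le_div_iff₀ (by positivity) (by norm_num)]
    nlinarith
  calc |∫ x, f x ∂ν - ∑ k ∈ Finset.range (d + 1), p.coeff k * u k|
      ≤ |∫ x, f x ∂ν - ∫ x, p.eval x ∂ν| +
        |∫ x, p.eval x ∂ν - ∑ k ∈ Finset.range (d + 1), p.coeff k * u k| := abs_sub_le _ _ _
    _ ≤ ε := by linarith

lemma abs_fussCatalan_le (s k : ℕ) : |fussCatalan s k| ≤ 2 * ((2 : ℝ) ^ s) ^ k := by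
  have h1 : ((s * k + 1).choose k : ℝ) ≤ (2 : ℝ) ^ (s * k + 1) := by
    exact_mod_cast Nat.choose_le_two_pow _ _
  have h2 : (1 : ℝ) ≤ (s : ℝ) * k + 1 := by
    have : (0 : ℝ) ≤ (s : ℝ) * k := by positivity
    linarith
  rw [fussCatalan, abs_of_nonneg (by positivity), ← pow_mul, ← pow_succ']
  exact (div_le_self (by positivity) h2).trans h1

lemma IsFussCatalan.exists_moments_near_imp {s : ℕ} {ρ : Measure ℝ} (h : IsFussCatalan s ρ)
    (f : ℝ →ᵇ ℝ) {ε : ℝ} (hε : 0 < ε) :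
    ∃ (D : ℕ) (η : ℝ), 0 < η ∧ ∀ ν : Measure ℝ, HasFiniteMoments ν →
      (∀ k ≤ D, |∫ x, x ^ k ∂ν - fussCatalan s k| ≤ η) → |∫ x, f x ∂ν - ∫ x, f x ∂ρ| ≤ ε := by
  obtain ⟨L, D, η, hη, H⟩ := exists_integral_near_of_moments_near
    (one_le_pow₀ (by norm_num)) (abs_fussCatalan_le s) f (half_pos hε)
  refine ⟨D, η, hη, fun ν hν hmom => ?_⟩
  have h1 := H ν hν hmom
  have h2 := H ρ h.hasFiniteMoments fun k _ => by simp [h.moment_eq k, hη.le]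
  rw [abs_sub_comm] at h2
  have h3 := abs_sub_le (∫ x, f x ∂ν) L (∫ x, f x ∂ρ)
  linarith

/-- The Fuss-Catalan distribution is determined by its moments, because they grow at most
geometrically. -/
lemma IsFussCatalan.unique {s : ℕ} {ρ ρ' : Measure ℝ} (h : IsFussCatalan s ρ)
    (h' : IsFussCatalan s ρ') : ρ' = ρ := by
  have := h.isProbabilityMeasure
  have := h'.isProbabilityMeasure
  refine ext_of_forall_integral_eq_of_IsFiniteMeasure fun f => ?_
  refine eq_of_abs_sub_le_all fun ε hε => ?_
  obtain ⟨D, η, hη, H⟩ := h.exists_moments_near_imp f hε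
  exact H ρ' h'.hasFiniteMoments fun k _ => by simp [h'.moment_eq k, hη.le]

/-! ### Gaussian integration by parts -/

lemma integrable_mul_gaussianPDFReal_iff {v : ℝ≥0} (hv : v ≠ 0) {f : ℝ → ℂ} :
    Integrable f (gaussianReal 0 v) ↔ Integrable (fun x => f x * (gaussianPDFReal 0 v x : ℂ)) := by
  rw [gaussianReal_of_var_ne_zero _ hv,
    integrable_withDensity_iff_integrable_smul' (measurable_gaussianPDF 0 v)
      (ae_of_all _ fun x => gaussianPDF_lt_top)]
  refine integrable_congr (ae_of_all _ fun x => ?_)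
  simp only [toReal_gaussianPDF, Complex.real_smul, mul_comm]

lemma integral_gaussianReal_eq_integral_mul {v : ℝ≥0} (hv : v ≠ 0) (f : ℝ → ℂ) :
    ∫ x, f x ∂gaussianReal 0 v = ∫ x, f x * (gaussianPDFReal 0 v x : ℂ) := by
  rw [integral_gaussianReal_eq_integral_smul hv]
  simp only [Complex.real_smul, mul_comm]

lemma hasDerivAt_gaussianPDFReal {v : ℝ≥0} (hv : v ≠ 0) (x : ℝ) :
    HasDerivAt (gaussianPDFReal 0 v) (-(x / v) * gaussianPDFReal 0 v x) x := by
  have hv' : (v : ℝ) ≠ 0 := by exact_mod_cast hv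
  have h : HasDerivAt (fun x : ℝ => -(x - 0) ^ 2 / (2 * (v : ℝ))) (-(x / v)) x := by
    have := ((((hasDerivAt_id x).sub_const 0).pow 2).neg).div_const (2 * (v : ℝ))
    refine this.congr_deriv ?_
    simp
    field_simp
  have h2 := (h.exp).const_mul (√(2 * Real.pi * v))⁻¹
  rw [gaussianPDFReal_def]
  refine h2.congr_deriv ?_
  ring

/-- Stein's identity for a real Gaussian variable and complex-valued test functions. -/
lemma integral_mul_gaussianReal (v : ℝ≥0) {f f' : ℝ → ℂ} (hf : ∀ x, HasDerivAt f (f' x) x)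
    (hi : Integrable f (gaussianReal 0 v)) (hi' : Integrable f' (gaussianReal 0 v))
    (hix : Integrable (fun x : ℝ => (x : ℂ) * f x) (gaussianReal 0 v)) :
    ∫ x, (x : ℂ) * f x ∂gaussianReal 0 v = v * ∫ x, f' x ∂gaussianReal 0 v := by
  rcases eq_or_ne v 0 with rfl | hv
  · simp
  have hv' : (v : ℂ) ≠ 0 := by exact_mod_cast hv
  have hg : ∀ x : ℝ, HasDerivAt (fun x : ℝ => (gaussianPDFReal 0 v x : ℂ))
      (-((x : ℂ) / v) * gaussianPDFReal 0 v x) x := by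
    intro x
    have := (hasDerivAt_gaussianPDFReal hv x).ofReal_comp
    refine this.congr_deriv ?_
    push_cast
    rfl
  rw [integrable_mul_gaussianPDFReal_iff hv] at hi hi' hix
  have key := integral_mul_deriv_eq_deriv_mul_of_integrable (u := f)
    (v := fun x => (gaussianPDFReal 0 v x : ℂ)) (fun x _ => hf x) (fun x _ => hg x)
    (by
      refine (hix.const_mul (-(v : ℂ)⁻¹)).congr (ae_of_all _ fun x => ?_)
      simp only [Pi.mul_apply]
      field_simp) hi' hi
  rw [integral_gaussianReal_eq_integral_mul hv, integral_gaussianReal_eq_integral_mul hv]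
  have h2 : ∀ x : ℝ, (x : ℂ) * f x * gaussianPDFReal 0 v x =
      -(v : ℂ) * (f x * (-((x : ℂ) / v) * gaussianPDFReal 0 v x)) := by
    intro x
    field_simp
  simp_rw [h2]
  rw [integral_const_mul, key]
  ring

/-- All polynomials in `z` and its conjugate are integrable against a complex Gaussian. -/
lemma memLp_id_complexGaussian (v : ℝ≥0) {p : ℝ≥0∞} (hp : p ≠ ∞) :
    MemLp id p (complexGaussian v) := by
  have hm : Measurable fun q : ℝ × ℝ => (q.1 : ℂ) + (q.2 : ℂ) * Complex.I := by fun_prop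
  rw [complexGaussian, memLp_map_measure_iff (by fun_prop) hm.aemeasurable]
  have h1 : MemLp (fun x : ℝ => (x : ℂ)) p (gaussianReal 0 (v / 2)) :=
    (memLp_id_gaussianReal' p hp).ofReal
  exact (h1.comp_fst _).add ((h1.comp_snd _).mul_const Complex.I)

/-- The random variable `X` has finite absolute moments of all orders. -/
def HasAllMoments {Ω : Type*} [MeasurableSpace Ω] (P : Measure Ω) (X : Ω → ℂ) : Prop :=
  ∀ p : ℝ≥0∞, p ≠ ∞ → MemLp X p P

namespace HasAllMoments

variable {Ω : Type*} [MeasurableSpace Ω] {P : Measure Ω} {X Y : Ω → ℂ}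

lemma integrable [IsFiniteMeasure P] (hX : HasAllMoments P X) : Integrable X P :=
  (hX 1 (by simp)).integrable le_rfl

lemma const [IsFiniteMeasure P] (c : ℂ) : HasAllMoments P fun _ => c := fun _ _ => memLp_const c

lemma add (hX : HasAllMoments P X) (hY : HasAllMoments P Y) :
    HasAllMoments P fun ω => X ω + Y ω := fun p hp => (hX p hp).add (hY p hp)

lemma mul (hX : HasAllMoments P X) (hY : HasAllMoments P Y) :
    HasAllMoments P fun ω => X ω * Y ω := by
  intro p hp
  have : ENNReal.HolderTriple (2 * p) (2 * p) p := ⟨by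
    rw [ENNReal.mul_inv (by simp) (by simp), ← add_mul, ENNReal.inv_two_add_inv_two, one_mul]⟩
  have h2 : 2 * p ≠ ∞ := ENNReal.mul_ne_top (by simp) hp
  exact (hY _ h2).mul' (hX _ h2)

lemma pow [IsFiniteMeasure P] (hX : HasAllMoments P X) (n : ℕ) :
    HasAllMoments P fun ω => X ω ^ n := by
  induction n with
  | zero => simpa using const 1
  | succ n ih => simpa [pow_succ] using ih.mul hX

lemma star (hX : HasAllMoments P X) : HasAllMoments P fun ω => starRingEnd ℂ (X ω) :=
  fun p hp => (hX p hp).star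

end HasAllMoments

lemma hasAllMoments_id_complexGaussian (v : ℝ≥0) : HasAllMoments (complexGaussian v) fun z => z :=
  fun _ hp => memLp_id_complexGaussian v hp

lemma hasAllMoments_ofReal_gaussianReal (v : ℝ≥0) :
    HasAllMoments (gaussianReal 0 v) fun x => (x : ℂ) :=
  fun p hp => (memLp_id_gaussianReal' p hp).ofReal

/-- Gaussian integration by parts, `E[z F] = v E[∂F/∂z̄]`, for a monomial `F` in `z` and its
conjugate. It is Stein's identity for the real and for the imaginary part, combined by
`2 ∂/∂z̄ = ∂/∂x + i ∂/∂y`. -/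
lemma integral_mul_monomial_complexGaussian (v : ℝ≥0) (a b : ℕ) :
    ∫ z, z * (z ^ a * starRingEnd ℂ z ^ b) ∂complexGaussian v =
      v * (b * ∫ z, z ^ a * starRingEnd ℂ z ^ (b - 1) ∂complexGaussian v) := by
  set γ := gaussianReal 0 (v / 2) with hγ
  have hm : Measurable fun q : ℝ × ℝ => (q.1 : ℂ) + (q.2 : ℂ) * Complex.I := by fun_prop
  set F : ℕ → ℕ → ℝ → ℝ → ℂ := fun a b x y =>
    ((x : ℂ) + y * Complex.I) ^ a * ((x : ℂ) - y * Complex.I) ^ b with hF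
  have hx : HasAllMoments γ fun x => (x : ℂ) := hasAllMoments_ofReal_gaussianReal _
  have hx2 : HasAllMoments (γ.prod γ) fun q => (q.1 : ℂ) := fun p hp => (hx p hp).comp_fst _
  have hy2 : HasAllMoments (γ.prod γ) fun q => (q.2 : ℂ) := fun p hp => (hx p hp).comp_snd _
  have hF2 : ∀ a b, HasAllMoments (γ.prod γ) fun q => F a b q.1 q.2 := by
    intro a b
    refine ((hx2.add (hy2.mul (.const _))).pow a).mul (HasAllMoments.pow ?_ b)
    simpa [sub_eq_add_neg] using hx2.add (hy2.mul (.const (-Complex.I)))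
  have hFx : ∀ a b y, HasAllMoments γ fun x => F a b x y := by
    intro a b y
    refine ((hx.add (.const _)).pow a).mul (HasAllMoments.pow ?_ b)
    simpa [sub_eq_add_neg] using hx.add (.const (-(y * Complex.I)))
  have hFy : ∀ a b x, HasAllMoments γ fun y => F a b x y := by
    intro a b x
    refine (((HasAllMoments.const _).add (hx.mul (.const _))).pow a).mul (HasAllMoments.pow ?_ b)
    simpa [sub_eq_add_neg] using (HasAllMoments.const (x : ℂ)).add (hx.mul (.const (-Complex.I)))
  have hdx : ∀ y x : ℝ, HasDerivAt (fun x => F a b x y)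
      (a * F (a - 1) b x y + b * F a (b - 1) x y) x := by
    intro y x
    have h0 := (hasDerivAt_id x).ofReal_comp
    have h1 := ((h0.add_const ((y : ℂ) * Complex.I)).pow a).mul
      ((h0.sub_const ((y : ℂ) * Complex.I)).pow b)
    refine h1.congr_deriv ?_
    simp [hF]
    ring
  have hdy : ∀ x y : ℝ, HasDerivAt (fun y => F a b x y)
      (Complex.I * (a * F (a - 1) b x y - b * F a (b - 1) x y)) y := by
    intro x y
    have h0 := (hasDerivAt_id y).ofReal_comp.mul_const Complex.I
    have h1 := ((h0.const_add (x : ℂ)).pow a).mul ((h0.const_sub (x : ℂ)).pow b)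
    refine h1.congr_deriv ?_
    simp [hF]
    ring
  have hxF : ∫ q, (q.1 : ℂ) * F a b q.1 q.2 ∂γ.prod γ =
      ((v / 2 : ℝ≥0) : ℂ) * ∫ q, (a * F (a - 1) b q.1 q.2 + b * F a (b - 1) q.1 q.2) ∂γ.prod γ := by
    rw [integral_prod_symm _ (hx2.mul (hF2 a b)).integrable, integral_prod_symm _
      (((HasAllMoments.const _).mul (hF2 _ b)).add ((HasAllMoments.const _).mul (hF2 a _))).integrable,
      ← integral_const_mul]
    refine integral_congr_ae (ae_of_all _ fun y => ?_)
    exact integral_mul_gaussianReal _ (hdx y) (hFx a b y).integrable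
      (((HasAllMoments.const _).mul (hFx _ b y)).add
        ((HasAllMoments.const _).mul (hFx a _ y))).integrable (hx.mul (hFx a b y)).integrable
  have hd : HasAllMoments (γ.prod γ)
      fun q => Complex.I * (a * F (a - 1) b q.1 q.2 - b * F a (b - 1) q.1 q.2) := by
    refine (HasAllMoments.const _).mul ?_
    simpa [sub_eq_add_neg] using
      ((HasAllMoments.const (a : ℂ)).mul (hF2 (a - 1) b)).add
        ((HasAllMoments.const (-(b : ℂ))).mul (hF2 a (b - 1)))
  have hyF : ∫ q, (q.2 : ℂ) * F a b q.1 q.2 ∂γ.prod γ =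
      ((v / 2 : ℝ≥0) : ℂ) *
        ∫ q, Complex.I * (a * F (a - 1) b q.1 q.2 - b * F a (b - 1) q.1 q.2) ∂γ.prod γ := by
    rw [integral_prod _ (hy2.mul (hF2 a b)).integrable, integral_prod _ hd.integrable,
      ← integral_const_mul]
    refine integral_congr_ae (ae_of_all _ fun x => ?_)
    refine integral_mul_gaussianReal _ (hdy x) (hFy a b x).integrable ?_
      (hx.mul (hFy a b x)).integrable
    refine HasAllMoments.integrable ((HasAllMoments.const _).mul ?_)
    simpa [sub_eq_add_neg] using
      ((HasAllMoments.const (a : ℂ)).mul (hFy (a - 1) b x)).add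
        ((HasAllMoments.const (-(b : ℂ))).mul (hFy a (b - 1) x))
  have hconj : ∀ x y : ℝ, starRingEnd ℂ ((x : ℂ) + y * Complex.I) = (x : ℂ) - y * Complex.I := by
    intro x y
    simp [sub_eq_add_neg]
  have hcont : Continuous (starRingEnd ℂ) := Complex.continuous_conj
  rw [complexGaussian, integral_map hm.aemeasurable (by fun_prop),
    integral_map hm.aemeasurable (by fun_prop)]
  simp only [hconj]
  change ∫ q : ℝ × ℝ, ((q.1 : ℂ) + q.2 * Complex.I) * F a b q.1 q.2 ∂γ.prod γ =
    v * (b * ∫ q : ℝ × ℝ, F a (b - 1) q.1 q.2 ∂γ.prod γ)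
  have hsplit : ∀ q : ℝ × ℝ, ((q.1 : ℂ) + q.2 * Complex.I) * F a b q.1 q.2 =
      q.1 * F a b q.1 q.2 + Complex.I * (q.2 * F a b q.1 q.2) := fun q => by ring
  simp_rw [hsplit]
  rw [integral_add (hx2.mul (hF2 a b)).integrable
    ((HasAllMoments.const _).mul (hy2.mul (hF2 a b))).integrable, integral_const_mul, hxF, hyF,
    mul_left_comm Complex.I, ← mul_add, ← integral_const_mul, ← integral_add
    (((HasAllMoments.const _).mul (hF2 _ b)).add ((HasAllMoments.const _).mul (hF2 a _))).integrable
    ((HasAllMoments.const _).mul hd).integrable, ← integral_const_mul, ← integral_const_mul,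
    ← integral_const_mul]
  refine integral_congr_ae (ae_of_all _ fun q => ?_)
  simp only
  have hI : Complex.I * Complex.I = -1 := Complex.I_mul_I
  push_cast
  linear_combination (v / 2 : ℂ) * (a * F (a - 1) b q.1 q.2 - b * F a (b - 1) q.1 q.2) * hI

/-! ### Polynomials in independent complex Gaussian variables -/

/-- The value of a polynomial in variables `(q, false)`, standing for `z q`, and `(q, true)`,
standing for the conjugate of `z q`. -/
noncomputable def conjEval {ι : Type*} (z : ι → ℂ) : MvPolynomial (ι × Bool) ℂ →ₐ[ℂ] ℂ :=
  MvPolynomial.aeval fun q => if q.2 then starRingEnd ℂ (z q.1) else z q.1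

/-- The monomial `z ^ d false * conj z ^ d true`. -/
noncomputable def conjMonomial (d : Bool → ℕ) (z : ℂ) : ℂ := z ^ d false * starRingEnd ℂ z ^ d true

lemma measurable_conjMonomial (d : Bool → ℕ) : Measurable (conjMonomial d) := by
  have hcont : Continuous (starRingEnd ℂ) := Complex.continuous_conj
  unfold conjMonomial
  fun_prop

lemma conjEval_monomial {ι : Type*} (z : ι → ℂ) (d : ι × Bool →₀ ℕ) (a : ℂ) {S : Finset ι}
    (hS : ∀ q ∈ d.support, q.1 ∈ S) :
    conjEval z (MvPolynomial.monomial d a) = a * ∏ q ∈ S, conjMonomial (fun b => d (q, b)) (z q) := by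
  rw [conjEval, MvPolynomial.aeval_monomial, Finsupp.prod_of_support_subset d
    (s := S ×ˢ Finset.univ) (fun q hq => by simp [hS q hq]) _ (by simp), Finset.prod_product]
  simp [conjMonomial, mul_comm]

lemma integral_mul_conjMonomial_complexGaussian (v : ℝ≥0) (d : Bool → ℕ) (b : Bool) :
    ∫ z, (if b then starRingEnd ℂ z else z) * conjMonomial d z ∂complexGaussian v =
      v * (d (!b) * ∫ z, conjMonomial (Function.update d (!b) (d (!b) - 1)) z
        ∂complexGaussian v) := by
  cases b with
  | false => simpa [conjMonomial] using integral_mul_monomial_complexGaussian v (d false) (d true)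
  | true =>
    have h := congrArg (starRingEnd ℂ)
      (integral_mul_monomial_complexGaussian v (d true) (d false))
    rw [map_mul, map_mul, ← integral_conj, ← integral_conj] at h
    simpa [conjMonomial, mul_comm (starRingEnd ℂ _ ^ _)] using h

section GaussianFamily

variable {Ω : Type*} [MeasurableSpace Ω] {P : Measure Ω} {ι : Type*} {X : ι → Ω → ℂ} {v : ℝ≥0}

lemma hasAllMoments_conjEval [IsProbabilityMeasure P]
    (hX : ∀ q, HasLaw (X q) (complexGaussian v) P)
    (F : MvPolynomial (ι × Bool) ℂ) : HasAllMoments P fun ω => conjEval (fun q => X q ω) F := by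
  have hXm : ∀ q, HasAllMoments P (X q) := by
    intro q p hp
    have h := hasAllMoments_id_complexGaussian v p hp
    rw [← (hX q).map_eq, memLp_map_measure_iff (by fun_prop) (hX q).aemeasurable] at h
    exact h
  induction F using MvPolynomial.induction_on with
  | C a => simpa [conjEval] using HasAllMoments.const a
  | add p q hp hq => simpa using hp.add hq
  | mul_X p q hp =>
    rcases q with ⟨q, _ | _⟩
    · simpa [conjEval] using hp.mul (hXm q)
    · simpa [conjEval] using hp.mul (hXm q).star

/-- Expectation, as a linear functional on polynomials in the Gaussian variables and their
conjugates. -/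
noncomputable def gaussianExpectation [IsProbabilityMeasure P]
    (hX : ∀ q, HasLaw (X q) (complexGaussian v) P) :
    MvPolynomial (ι × Bool) ℂ →ₗ[ℂ] ℂ where
  toFun F := ∫ ω, conjEval (fun q => X q ω) F ∂P
  map_add' F F' := by
    simp only [map_add]
    exact integral_add (hasAllMoments_conjEval hX F).integrable
      (hasAllMoments_conjEval hX F').integrable
  map_smul' c F := by
    simp only [map_smul, smul_eq_mul, RingHom.id_apply]
    exact integral_const_mul _ _

lemma integral_mul_prod_of_iIndepFun (hX : ∀ q, HasLaw (X q) (complexGaussian v) P)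
    (hind : iIndepFun X P) {p : ι} {S : Finset ι} (hp : p ∉ S) {g : ℂ → ℂ} (hg : Measurable g)
    {h : ι → ℂ → ℂ} (hh : ∀ q, Measurable (h q)) :
    ∫ ω, g (X p ω) * ∏ q ∈ S, h q (X q ω) ∂P =
      (∫ z, g z ∂complexGaussian v) * ∫ ω, ∏ q ∈ S, h q (X q ω) ∂P := by
  classical
  set k : ι → ℂ → ℂ := Function.update h p g with hk
  have hkm : ∀ q, Measurable (k q) := by
    intro q
    rcases eq_or_ne q p with rfl | hqp
    · simpa [hk] using hg
    · simpa [hk, hqp] using hh q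
  have hkX : ∀ q, AEMeasurable (k q ∘ X q) P := fun q =>
    (hkm q).comp_aemeasurable (hX q).aemeasurable
  have hind' : iIndepFun (fun q => k q ∘ X q) P :=
    hind.comp₀ k (fun q => (hX q).aemeasurable) fun q => (hkm q).aemeasurable
  have hpair := (hind'.indepFun_finsetProd_of_notMem₀ hkX hp).symm
  have hprod : (∏ q ∈ S, k q ∘ X q) = fun ω => ∏ q ∈ S, h q (X q ω) := by
    ext ω
    rw [Finset.prod_apply]
    refine Finset.prod_congr rfl fun q hq => ?_
    have hqp : q ≠ p := fun e => hp (e ▸ hq)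
    simp [hk, hqp]
  have hkp : k p ∘ X p = fun ω => g (X p ω) := by
    ext ω
    simp [hk]
  have hm2 : AEMeasurable (∏ q ∈ S, k q ∘ X q) P := Finset.aemeasurable_prod _ fun q _ => hkX q
  have hkXp := hkX p
  rw [hprod] at hpair hm2
  rw [hkp] at hpair hkXp
  rw [hpair.integral_fun_mul_eq_mul_integral hkXp.aestronglyMeasurable hm2.aestronglyMeasurable,
    ← (hX p).map_eq, integral_map (hX p).aemeasurable hg.aestronglyMeasurable]

/-- Gaussian integration by parts: multiplication by a variable becomes differentiation with
respect to its conjugate. -/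
lemma gaussianExpectation_X_mul [IsProbabilityMeasure P]
    (hX : ∀ q, HasLaw (X q) (complexGaussian v) P)
    (hind : iIndepFun X P) (p : ι) (b : Bool) (F : MvPolynomial (ι × Bool) ℂ) :
    gaussianExpectation hX (MvPolynomial.X (p, b) * F) =
      v * gaussianExpectation hX (MvPolynomial.pderiv (p, !b) F) := by
  classical
  induction F using MvPolynomial.induction_on' with
  | add F F' hF hF' => rw [mul_add, map_add, hF, hF', map_add, map_add, mul_add]
  | monomial d a =>
    set T := (d.support.image Prod.fst).erase p with hT
    have hpT : p ∉ T := by simp [hT]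
    have hsupp : ∀ q ∈ d.support, q.1 ∈ insert p T := by
      intro q hq
      by_cases h : q.1 = p
      · simp [h]
      · exact Finset.mem_insert_of_mem
          (Finset.mem_erase.2 ⟨h, Finset.mem_image_of_mem _ hq⟩)
    set d' := d - Finsupp.single (p, !b) 1 with hd'
    have hsupp' : ∀ q ∈ d'.support, q.1 ∈ insert p T := by
      intro q hq
      refine hsupp q (Finsupp.mem_support_iff.2 fun h0 => ?_)
      simp [hd', h0] at hq
    have hd'p : (fun c => d' (p, c)) =
        Function.update (fun c => d (p, c)) (!b) (d (p, !b) - 1) := by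
      ext c
      by_cases hc : c = !b
      · subst hc
        simp [hd']
      · have : (p, !b) ≠ (p, c) := fun e => hc (Prod.ext_iff.1 e).2.symm
        simp [hd', hc]
    have hd'q : ∀ q ∈ T, (fun c => d' (q, c)) = fun c => d (q, c) := by
      intro q hq
      ext c
      have : (p, !b) ≠ (q, c) := fun e =>
        hpT (by rwa [show p = q from congrArg Prod.fst e])
      simp [hd', this]
    have hL : ∀ ω, conjEval (fun q => X q ω) (MvPolynomial.X (p, b) * MvPolynomial.monomial d a) =
        a * (((if b then starRingEnd ℂ (X p ω) else X p ω) *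
          conjMonomial (fun c => d (p, c)) (X p ω)) *
          ∏ q ∈ T, conjMonomial (fun c => d (q, c)) (X q ω)) := by
      intro ω
      rw [map_mul, conjEval_monomial _ _ _ hsupp, Finset.prod_insert hpT]
      simp only [conjEval, MvPolynomial.aeval_X]
      ring
    have hR : ∀ ω, conjEval (fun q => X q ω)
        (MvPolynomial.pderiv (p, !b) (MvPolynomial.monomial d a)) =
        (a * d (p, !b)) * (conjMonomial (Function.update (fun c => d (p, c)) (!b) (d (p, !b) - 1))
          (X p ω) * ∏ q ∈ T, conjMonomial (fun c => d (q, c)) (X q ω)) := by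
      intro ω
      rw [MvPolynomial.pderiv_monomial, conjEval_monomial _ _ _ hsupp', Finset.prod_insert hpT, hd'p]
      congr 2
      exact Finset.prod_congr rfl fun q hq => by rw [hd'q q hq]
    have hmeas : Measurable fun z : ℂ =>
        (if b then starRingEnd ℂ z else z) * conjMonomial (fun c => d (p, c)) z := by
      have hcont : Continuous (starRingEnd ℂ) := Complex.continuous_conj
      refine Measurable.mul ?_ (measurable_conjMonomial _)
      cases b
      · exact measurable_id
      · simpa using hcont.measurable
    simp only [gaussianExpectation, LinearMap.coe_mk, AddHom.coe_mk, hL, hR, integral_const_mul]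
    rw [integral_mul_prod_of_iIndepFun hX hind hpT hmeas fun q => measurable_conjMonomial _,
      integral_mul_prod_of_iIndepFun hX hind hpT (measurable_conjMonomial _)
        fun q => measurable_conjMonomial _,
      integral_mul_conjMonomial_complexGaussian]
    ring

end GaussianFamily

/-! ### Loop equations for traces of words -/

section LoopEquation

variable {N : ℕ}

/-- The variable that stands for the entry `(a, c)` of the letter `l`. -/
def entryVar (l : ℕ × Bool) (a c : Fin N) : (ℕ × Fin N × Fin N) × Bool :=
  if l.2 then ((l.1, c, a), true) else ((l.1, a, c), false)

lemma entryVar_inj {l l' : ℕ × Bool} {a a' c c' : Fin N} :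
    entryVar l a c = entryVar l' a' c' ↔ l = l' ∧ a = a' ∧ c = c' := by
  rcases l with ⟨i, _ | _⟩ <;> rcases l' with ⟨i', _ | _⟩ <;> simp [entryVar, and_comm]

lemma entryVar_letterStar (l : ℕ × Bool) (a c : Fin N) :
    entryVar (letterStar l) c a = ((entryVar l a c).1, !(entryVar l a c).2) := by
  rcases l with ⟨i, _ | _⟩ <;> simp [entryVar, letterStar]

/-- The generic matrix of a letter. -/
noncomputable def letterMatrix (l : ℕ × Bool) :
    Matrix (Fin N) (Fin N) (MvPolynomial ((ℕ × Fin N × Fin N) × Bool) ℂ) :=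
  Matrix.of fun a c => MvPolynomial.X (entryVar l a c)

/-- The generic matrix of a word. -/
noncomputable def genericWord (u : List (ℕ × Bool)) :
    Matrix (Fin N) (Fin N) (MvPolynomial ((ℕ × Fin N × Fin N) × Bool) ℂ) :=
  (u.map letterMatrix).prod

lemma genericWord_nil : genericWord (N := N) [] = 1 := rfl

lemma genericWord_cons (l : ℕ × Bool) (u : List (ℕ × Bool)) :
    genericWord (N := N) (l :: u) = letterMatrix l * genericWord u := by
  simp [genericWord]

lemma genericWord_append (u u' : List (ℕ × Bool)) :
    genericWord (N := N) (u ++ u') = genericWord u * genericWord u' := by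
  simp [genericWord]

/-- The product of the traces of several generic words. -/
noncomputable def traceProd (N : ℕ) (U : List (List (ℕ × Bool))) :
    MvPolynomial ((ℕ × Fin N × Fin N) × Bool) ℂ :=
  (U.map fun u => (genericWord u).trace).prod

lemma traceProd_cons (u : List (ℕ × Bool)) (U : List (List (ℕ × Bool))) :
    traceProd N (u :: U) = (genericWord u).trace * traceProd N U := by
  simp [traceProd]

/-- Differentiating an entry of a word with respect to an entry of a letter cuts the word at each
occurrence of that letter. -/
lemma pderiv_genericWord (l : ℕ × Bool) (a c : Fin N) (u : List (ℕ × Bool)) (x y : Fin N) :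
    MvPolynomial.pderiv (entryVar l a c) (genericWord u x y) =
      ((cuts l u).map fun p => genericWord p.1 x a * genericWord p.2 c y).sum := by
  induction u generalizing x with
  | nil =>
    rw [genericWord_nil, cuts]
    by_cases h : x = y <;> simp [Matrix.one_apply, h]
  | cons l' v ih =>
    have hsum : ∀ (L : List (List (ℕ × Bool) × List (ℕ × Bool))),
        (L.map fun p => genericWord (l' :: p.1) x a * genericWord p.2 c y).sum =
          ∑ z, letterMatrix l' x z *
            (L.map fun p => genericWord p.1 z a * genericWord p.2 c y).sum := by
      intro L
      induction L with
      | nil => simp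
      | cons p L ihL =>
        simp only [List.map_cons, List.sum_cons, mul_add, Finset.sum_add_distrib, ihL]
        rw [genericWord_cons, Matrix.mul_apply, Finset.sum_mul]
        simp only [mul_assoc]
    have hd : ∀ z, MvPolynomial.pderiv (entryVar l a c) (letterMatrix l' x z) =
        if l' = l ∧ x = a ∧ z = c then 1 else 0 := by
      intro z
      simp only [letterMatrix, Matrix.of_apply, MvPolynomial.pderiv_X, Pi.single_apply, entryVar_inj]
    rw [genericWord_cons, Matrix.mul_apply, map_sum]
    simp only [Derivation.leibniz, smul_eq_mul, ih, hd, Finset.sum_add_distrib]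
    rw [cuts, List.map_append, List.sum_append, List.map_map, add_comm]
    congr 1
    · by_cases hl : l' = l
      · by_cases hx : x = a
        · simp [hl, hx, genericWord_nil]
        · simp [hl, hx, genericWord_nil]
      · simp [hl]
    · exact (hsum _).symm

/-- The families of words obtained from `U` by removing an occurrence of `l` from one of its words,
cutting this cyclic word open there, and appending it to `v`. -/
def merges (l : ℕ × Bool) (v : List (ℕ × Bool)) :
    List (List (ℕ × Bool)) → List (List (List (ℕ × Bool)))
  | [] => []
  | u :: U => (cuts l u).map (fun p => (v ++ p.2 ++ p.1) :: U) ++ (merges l v U).map (u :: ·)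

lemma sum_pderiv_trace (l : ℕ × Bool) (v u : List (ℕ × Bool)) :
    ∑ a, ∑ c, genericWord v c a *
      MvPolynomial.pderiv (entryVar (N := N) l c a) (genericWord u).trace =
      ((cuts l u).map fun p => (genericWord (v ++ p.2 ++ p.1)).trace).sum := by
  simp only [Matrix.trace, Matrix.diag, map_sum, pderiv_genericWord]
  induction cuts l u with
  | nil => simp
  | cons p L ih =>
    simp only [List.map_cons, List.sum_cons, Finset.sum_add_distrib, mul_add, ih]
    congr 1
    simp only [genericWord_append, Matrix.mul_apply, Finset.mul_sum, Finset.sum_mul]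
    rw [Finset.sum_comm]
    refine Finset.sum_congr rfl fun c _ => ?_
    rw [Finset.sum_comm]
    refine Finset.sum_congr rfl fun x _ => Finset.sum_congr rfl fun a _ => ?_
    ring

lemma sum_pderiv_traceProd (l : ℕ × Bool) (v : List (ℕ × Bool)) (U : List (List (ℕ × Bool))) :
    ∑ a, ∑ c, genericWord v c a *
      MvPolynomial.pderiv (entryVar (N := N) l c a) (traceProd N U) =
      ((merges l v U).map (traceProd N)).sum := by
  induction U with
  | nil => simp [merges, traceProd]
  | cons u U ih =>
    have h1 : ∀ L : List (List (ℕ × Bool) × List (ℕ × Bool)),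
        (L.map fun p => traceProd N ((v ++ p.2 ++ p.1) :: U)).sum =
          (L.map fun p => (genericWord (N := N) (v ++ p.2 ++ p.1)).trace).sum * traceProd N U := by
      intro L
      rw [← List.sum_map_mul_right]
      simp only [traceProd_cons]
    have h2 : ∀ L : List (List (List (ℕ × Bool))),
        (L.map fun U' => traceProd N (u :: U')).sum =
          (genericWord (N := N) u).trace * (L.map (traceProd N)).sum := by
      intro L
      rw [← List.sum_map_mul_left]
      simp only [traceProd_cons]
    rw [merges, List.map_append, List.sum_append, List.map_map, List.map_map]
    refine Eq.trans ?_ (congrArg₂ (· + ·) (h1 _) (h2 _)).symm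
    rw [← sum_pderiv_trace, ← ih, Finset.sum_mul, Finset.mul_sum, ← Finset.sum_add_distrib]
    refine Finset.sum_congr rfl fun a _ => ?_
    rw [Finset.sum_mul, Finset.mul_sum, ← Finset.sum_add_distrib]
    refine Finset.sum_congr rfl fun c _ => ?_
    rw [traceProd_cons, Derivation.leibniz]
    simp only [smul_eq_mul]
    ring

/-- The Schwinger-Dyson equation: integration by parts in the first letter of a trace splits that
trace in two, or merges it with one of the other traces. -/
lemma loop_equation {E : MvPolynomial ((ℕ × Fin N × Fin N) × Bool) ℂ →ₗ[ℂ] ℂ} {v : ℂ}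
    (hE : ∀ p b F, E (MvPolynomial.X (p, b) * F) = v * E (MvPolynomial.pderiv (p, !b) F))
    (l : ℕ × Bool) (u : List (ℕ × Bool)) (U : List (List (ℕ × Bool))) :
    E (traceProd N ((l :: u) :: U)) =
      v * (((cuts (letterStar l) u).map fun p => E (traceProd N (p.1 :: p.2 :: U))).sum +
        ((merges (letterStar l) u U).map fun U' => E (traceProd N U')).sum) := by
  have hE' : ∀ (a c : Fin N) F, E (letterMatrix l a c * F) =
      v * E (MvPolynomial.pderiv (entryVar (letterStar l) c a) F) := by
    intro a c F
    rw [entryVar_letterStar]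
    exact hE _ _ F
  have hsplit : ∑ a, ∑ c, traceProd N U *
      MvPolynomial.pderiv (entryVar (N := N) (letterStar l) c a) (genericWord u c a) =
      ((cuts (letterStar l) u).map fun p => traceProd N (p.1 :: p.2 :: U)).sum := by
    simp only [pderiv_genericWord]
    induction cuts (letterStar l) u with
    | nil => simp
    | cons p L ih =>
      simp only [List.map_cons, List.sum_cons, Finset.sum_add_distrib, mul_add, ih]
      congr 1
      rw [traceProd_cons, traceProd_cons, Matrix.trace, Matrix.trace, ← mul_assoc,
        Finset.sum_mul_sum, Finset.sum_mul, Finset.sum_comm]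
      refine Finset.sum_congr rfl fun c _ => ?_
      rw [Finset.sum_mul]
      refine Finset.sum_congr rfl fun a _ => ?_
      simp only [Matrix.diag]
      ring
  have hexp : traceProd N ((l :: u) :: U) =
      ∑ a, ∑ c, letterMatrix l a c * (genericWord u c a * traceProd N U) := by
    rw [traceProd_cons, genericWord_cons, Matrix.trace, Finset.sum_mul]
    refine Finset.sum_congr rfl fun a _ => ?_
    rw [Matrix.diag, Matrix.mul_apply, Finset.sum_mul]
    simp only [mul_assoc]
  rw [hexp]
  simp only [map_sum, hE', ← Finset.mul_sum]
  congr 1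
  simp only [← map_sum, Derivation.leibniz, smul_eq_mul, Finset.sum_add_distrib]
  rw [hsplit, sum_pderiv_traceProd, map_add, map_list_sum, map_list_sum, List.map_map, List.map_map,
    add_comm]
  rfl

end LoopEquation

/-! ### Large-`N` limit of the loop equations -/

/-- The quantity on which the induction on the loop equations runs. -/
def familySize (U : List (List (ℕ × Bool))) : ℕ := (U.map fun u => u.length + 1).sum

lemma of_mem_merges {l : ℕ × Bool} {v : List (ℕ × Bool)} {U U' : List (List (ℕ × Bool))}
    (h : U' ∈ merges l v U) :
    U'.length = U.length ∧ familySize U' < familySize U + v.length + 2 := by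
  induction U generalizing U' with
  | nil => simp [merges] at h
  | cons u U ih =>
    simp only [merges, List.mem_append, List.mem_map] at h
    rcases h with ⟨p, hp, rfl⟩ | ⟨V, hV, rfl⟩
    · have := length_of_mem_cuts hp
      simp only [familySize, List.length_cons, List.map_cons, List.sum_cons, List.length_append]
      exact ⟨trivial, by omega⟩
    · have := ih hV
      simp only [familySize, List.length_cons, List.map_cons, List.sum_cons] at this ⊢
      omega

/-- The loop equations, normalised, determine the limits of all mixed moments of traces: the limit
factorises over the traces, and each factor counts noncrossing pairings. -/
lemma tendsto_of_loop_equations {e : ℕ → List (List (ℕ × Bool)) → ℂ}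
    (h_nil : ∀ N, e N [] = 1) (h_one : ∀ N, N ≠ 0 → ∀ U, e N ([] :: U) = e N U)
    (h_loop : ∀ N, N ≠ 0 → ∀ l u U, e N ((l :: u) :: U) =
      ((cuts (letterStar l) u).map fun p => e N (p.1 :: p.2 :: U)).sum +
        ((N : ℂ) ^ 2)⁻¹ * ((merges (letterStar l) u U).map fun U' => e N U').sum)
    (U : List (List (ℕ × Bool))) :
    Tendsto (fun N => e N U) atTop (𝓝 (U.map fun u => (wick u : ℂ)).prod) := by
  induction hn : familySize U using Nat.strong_induction_on generalizing U with
  | _ n ih =>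
    rcases U with _ | ⟨_ | ⟨l, u⟩, U⟩
    · simp [h_nil]
    · have h := ih (familySize U) (by simp [familySize] at hn ⊢; omega) U rfl
      simp only [List.map_cons, List.prod_cons, wick_nil, Nat.cast_one, one_mul]
      refine h.congr' ?_
      filter_upwards [eventually_ne_atTop 0] with N hN using (h_one N hN U).symm
    · have hsize : n = u.length + 2 + familySize U := by
        rw [← hn]
        simp [familySize]
      have h1 : Tendsto (fun N => ((cuts (letterStar l) u).map fun p => e N (p.1 :: p.2 :: U)).sum)
          atTop (𝓝 ((cuts (letterStar l) u).map fun p =>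
            ((p.1 :: p.2 :: U).map fun u => (wick u : ℂ)).prod).sum) := by
        refine tendsto_list_sum _ fun p hp => ih _ ?_ _ rfl
        have := length_of_mem_cuts hp
        simp only [familySize, List.map_cons, List.sum_cons] at hsize ⊢
        omega
      have h2 : Tendsto (fun N => ((merges (letterStar l) u U).map fun U' => e N U').sum)
          atTop (𝓝 ((merges (letterStar l) u U).map fun U' =>
            (U'.map fun u => (wick u : ℂ)).prod).sum) := by
        refine tendsto_list_sum _ fun U' hU' => ih _ ?_ _ rfl
        have := (of_mem_merges hU').2
        omega
      have h3 : Tendsto (fun N : ℕ => ((N : ℂ) ^ 2)⁻¹) atTop (𝓝 0) := by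
        have h4 := (tendsto_inv_atTop_nhds_zero_nat (𝕜 := ℂ)).pow 2
        simpa using h4
      have hlim := h1.add (h3.mul h2)
      have hval : ((cuts (letterStar l) u).map fun p =>
            ((p.1 :: p.2 :: U).map fun u => (wick u : ℂ)).prod).sum =
          (((l :: u) :: U).map fun u => (wick u : ℂ)).prod := by
        simp only [List.map_cons, List.prod_cons, ← mul_assoc]
        rw [List.sum_map_mul_right, wick_cons, Nat.cast_list_sum, List.map_map]
        simp [Function.comp_def]
      rw [zero_mul, add_zero, hval] at hlim
      refine hlim.congr' ?_
      filter_upwards [eventually_ne_atTop 0] with N hN using (h_loop N hN l u U).symm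

/-! ### Moments of the empirical measure of squared singular values -/

section SingularValues

variable {N : ℕ}

lemma trace_toEuclideanLin (A : Matrix (Fin N) (Fin N) ℂ) :
    LinearMap.trace ℂ _ (Matrix.toEuclideanLin A) = A.trace := by
  rw [Matrix.toEuclideanLin, Matrix.toLpLin_eq_toLin]
  exact A.trace_toLin_eq _

lemma toEuclideanLin_mul (A B : Matrix (Fin N) (Fin N) ℂ) :
    Matrix.toEuclideanLin (A * B) = Matrix.toEuclideanLin A * Matrix.toEuclideanLin B := by
  simp only [Matrix.toLpLin_eq_toLin]
  exact Matrix.toLin_mul _ _ _ A B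

lemma toEuclideanLin_pow (A : Matrix (Fin N) (Fin N) ℂ) (k : ℕ) :
    Matrix.toEuclideanLin (A ^ k) = Matrix.toEuclideanLin A ^ k := by
  induction k with
  | zero =>
    simp only [pow_zero, Matrix.toLpLin_eq_toLin]
    exact Matrix.toLin_one _
  | succ k ih => rw [pow_succ, toEuclideanLin_mul, ih, pow_succ]

lemma trace_pow_eq_sum_eigenvalues_pow {T : EuclideanSpace ℂ (Fin N) →ₗ[ℂ] EuclideanSpace ℂ (Fin N)}
    (hT : T.IsSymmetric) (hn : Module.finrank ℂ (EuclideanSpace ℂ (Fin N)) = N) (k : ℕ) :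
    LinearMap.trace ℂ _ (T ^ k) = ∑ j, ((hT.eigenvalues hn j ^ k : ℝ) : ℂ) := by
  rw [LinearMap.trace_eq_sum_inner _ (hT.eigenvectorBasis hn)]
  refine Finset.sum_congr rfl fun j _ => ?_
  have h : (T ^ k) (hT.eigenvectorBasis hn j) =
      ((hT.eigenvalues hn j ^ k : ℝ) : ℂ) • hT.eigenvectorBasis hn j := by
    induction k with
    | zero => simp
    | succ k ih =>
      rw [pow_succ', Module.End.mul_apply, ih, map_smul, hT.apply_eigenvectorBasis, smul_smul]
      push_cast
      rw [pow_succ]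
      rfl
  rw [h, inner_smul_right]
  simp

lemma trace_star_mul_pow (A : Matrix (Fin N) (Fin N) ℂ) (k : ℕ) :
    ((A.conjTranspose * A) ^ k).trace = ((A * A.conjTranspose) ^ k).trace := by
  cases k with
  | zero => simp
  | succ k =>
    have h : A * (A.conjTranspose * A) ^ k = (A * A.conjTranspose) ^ k * A := by
      induction k with
      | zero => simp
      | succ k ih => rw [pow_succ, ← mul_assoc, ih, pow_succ]; simp only [mul_assoc]
    rw [pow_succ', mul_assoc, Matrix.trace_mul_comm, h, mul_assoc, ← pow_succ]

/-- The moments of the squared singular values of `A` are traces of powers of `A A^*`. -/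
lemma sum_singularValues_pow (A : Matrix (Fin N) (Fin N) ℂ) (k : ℕ) :
    ((∑ j : Fin N, ((Matrix.toEuclideanLin A).singularValues j ^ 2) ^ k : ℝ) : ℂ) =
      ((A * A.conjTranspose) ^ k).trace := by
  have hn : Module.finrank ℂ (EuclideanSpace ℂ (Fin N)) = N := finrank_euclideanSpace_fin
  rw [← trace_star_mul_pow, ← trace_toEuclideanLin, toEuclideanLin_pow, toEuclideanLin_mul,
    Matrix.toEuclideanLin_conjTranspose_eq_adjoint]
  have h := trace_pow_eq_sum_eigenvalues_pow
    (Matrix.toEuclideanLin A).isSymmetric_adjoint_comp_self hn k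
  push_cast at h ⊢
  refine Eq.trans (Finset.sum_congr rfl fun j _ => ?_) h.symm
  rw [← LinearMap.sq_singularValues_fin]
  push_cast
  rfl

lemma integrable_squaredSingularValueMeasure (hN : N ≠ 0) (A : Matrix (Fin N) (Fin N) ℂ)
    (g : ℝ → ℝ) : Integrable g (squaredSingularValueMeasure A) := by
  refine Integrable.smul_measure ?_ (by simp [hN])
  exact integrable_finsetSum_measure.2 fun j _ => integrable_dirac (by simp)

lemma hasFiniteMoments_squaredSingularValueMeasure (hN : N ≠ 0) (A : Matrix (Fin N) (Fin N) ℂ) :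
    HasFiniteMoments (squaredSingularValueMeasure A) where
  isProbabilityMeasure := ⟨by
    simp only [squaredSingularValueMeasure, Measure.smul_apply, Measure.finsetSum_apply,
      measure_univ, Finset.sum_const, Finset.card_univ, Fintype.card_fin, smul_eq_mul, nsmul_eq_mul,
      mul_one]
    exact ENNReal.inv_mul_cancel (by simpa using hN) (by simp)⟩
  nonneg := by
    simp only [squaredSingularValueMeasure, Measure.smul_apply, Measure.finsetSum_apply,
      Measure.dirac_apply' _ measurableSet_Iio]
    rw [Finset.sum_eq_zero, smul_zero]
    intro j _
    exact Set.indicator_of_notMem (by simpa using sq_nonneg _) _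
  integrable_pow k := integrable_squaredSingularValueMeasure hN A _

lemma integral_pow_squaredSingularValueMeasure (A : Matrix (Fin N) (Fin N) ℂ) (k : ℕ) :
    ((∫ x, x ^ k ∂squaredSingularValueMeasure A : ℝ) : ℂ) =
      (N : ℂ)⁻¹ * ((A * A.conjTranspose) ^ k).trace := by
  rw [← sum_singularValues_pow, squaredSingularValueMeasure, integral_smul_measure,
    integral_finsetSum_measure fun j _ => integrable_dirac (by simp)]
  simp

end SingularValues

/-! ### Convergence of the moments -/

section Ginibre

/-- The Ginibre entries, as a family indexed by the variables of generic words. -/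
def ginibreEntry {Ω : Type*} {N : ℕ} (G : ℕ → Ω → Matrix (Fin N) (Fin N) ℂ)
    (q : ℕ × Fin N × Fin N) (ω : Ω) : ℂ :=
  G q.1 ω q.2.1 q.2.2

/-- Evaluated at the Ginibre matrices, the generic word `(w w^*)^k` becomes `(G_w G_w^*)^k`. -/
lemma conjEval_trace_powerWord {Ω : Type*} {N : ℕ} (G : ℕ → Ω → Matrix (Fin N) (Fin N) ℂ)
    (ω : Ω) (w : List ℕ) (k : ℕ) :
    conjEval (fun q => ginibreEntry G q ω) (genericWord (powerWord w k)).trace =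
      ((wordMatrix (fun i => G i ω) w * (wordMatrix (fun i => G i ω) w).conjTranspose) ^ k).trace := by
  set φ := (conjEval fun q => ginibreEntry G q ω).mapMatrix (m := Fin N) with hφ
  have hletter : ∀ l, φ (letterMatrix l) = if l.2 then (G l.1 ω).conjTranspose else G l.1 ω := by
    rintro ⟨i, _ | _⟩ <;> ext a c <;>
      simp [hφ, letterMatrix, entryVar, conjEval, ginibreEntry]
  have hword : ∀ u : List (ℕ × Bool), φ (genericWord u) = (u.map fun l => φ (letterMatrix l)).prod := by
    intro u
    rw [genericWord, map_list_prod, List.map_map]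
    rfl
  have hplain : φ (genericWord (plainWord w)) = wordMatrix (fun i => G i ω) w := by
    rw [hword, plainWord, List.map_map, wordMatrix]
    simp [hletter, Function.comp_def]
  have hadj : φ (genericWord (adjointWord w)) =
      (wordMatrix (fun i => G i ω) w).conjTranspose := by
    rw [hword, adjointWord, List.map_reverse, List.map_map, wordMatrix,
      Matrix.conjTranspose_list_prod, List.map_map]
    simp [hletter, Function.comp_def]
  have hpow : φ (genericWord (powerWord w k)) =
      (wordMatrix (fun i => G i ω) w * (wordMatrix (fun i => G i ω) w).conjTranspose) ^ k := by
    induction k with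
    | zero => simp [powerWord, genericWord_nil]
    | succ k ih =>
      have : powerWord w (k + 1) = (plainWord w ++ adjointWord w) ++ powerWord w k := by
        simp [powerWord, List.replicate_succ]
      rw [this, genericWord_append, genericWord_append, map_mul, map_mul, hplain, hadj, ih, pow_succ']
  rw [← hpow]
  exact AddMonoidHom.map_trace (conjEval fun q => ginibreEntry G q ω) _

variable {Ω : ℕ → Type*} [∀ N, MeasurableSpace (Ω N)] {P : ∀ N, Measure (Ω N)}
  [∀ N, IsProbabilityMeasure (P N)] {G : ∀ N, ℕ → Ω N → Matrix (Fin N) (Fin N) ℂ}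

lemma IsGinibreSequence.hasLaw_ginibreEntry {Ω : Type*} [MeasurableSpace Ω] {P : Measure Ω}
    {N : ℕ} {G : ℕ → Ω → Matrix (Fin N) (Fin N) ℂ} (hG : IsGinibreSequence G P)
    (q : ℕ × Fin N × Fin N) : HasLaw (ginibreEntry G q) (complexGaussian ((N : ℝ≥0)⁻¹)) P :=
  hG.hasLaw q.1 q.2.1 q.2.2

/-- The mixed moments of normalised traces of words converge; the limit factorises. -/
lemma tendsto_gaussianExpectation_traceProd (hG : ∀ N, IsGinibreSequence (G N) (P N))
    (U : List (List (ℕ × Bool))) :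
    Tendsto (fun N : ℕ => ((N : ℂ) ^ U.length)⁻¹ *
      gaussianExpectation (hG N).hasLaw_ginibreEntry (traceProd N U)) atTop
      (𝓝 (U.map fun u => (wick u : ℂ)).prod) := by
  refine tendsto_of_loop_equations (e := fun N U => ((N : ℂ) ^ U.length)⁻¹ *
      gaussianExpectation (hG N).hasLaw_ginibreEntry (traceProd N U)) ?_ ?_ ?_ U
  · intro N
    simp [traceProd, gaussianExpectation]
  · intro N hN U
    have hN' : (N : ℂ) ≠ 0 := by exact_mod_cast hN
    have h : traceProd N ([] :: U) = (N : ℂ) • traceProd N U := by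
      rw [traceProd_cons, genericWord_nil, Matrix.trace_one, Fintype.card_fin,
        ← MvPolynomial.C_mul']
      simp
    simp only [h, map_smul, smul_eq_mul, List.length_cons, pow_succ]
    field_simp
  · intro N hN l u U
    have hN' : (N : ℂ) ≠ 0 := by exact_mod_cast hN
    have hloop := loop_equation
      (E := gaussianExpectation (hG N).hasLaw_ginibreEntry) (v := (N : ℂ)⁻¹)
      (fun p b F => by
        have := gaussianExpectation_X_mul (hG N).hasLaw_ginibreEntry (hG N).indep p b F
        simpa using this) l u U
    have hm : ((merges (letterStar l) u U).map fun U' => ((N : ℂ) ^ U'.length)⁻¹ *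
          gaussianExpectation (hG N).hasLaw_ginibreEntry (traceProd N U')) =
        (merges (letterStar l) u U).map fun U' => ((N : ℂ) ^ U.length)⁻¹ *
          gaussianExpectation (hG N).hasLaw_ginibreEntry (traceProd N U') :=
      List.map_congr_left fun U' hU' => by rw [(of_mem_merges hU').1]
    rw [hm]
    simp only [List.length_cons, hloop, List.sum_map_mul_left, pow_succ]
    field_simp

/-- The moments of the empirical measures converge to the Fuss-Catalan numbers in `L²`. -/
lemma tendsto_integral_sq_moment_sub (hG : ∀ N, IsGinibreSequence (G N) (P N)) (w : List ℕ)
    (k : ℕ) :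
    Tendsto (fun N => ∫ ω, (∫ x, x ^ k ∂squaredSingularValueMeasure
      (wordMatrix (fun i => G N i ω) w) - fussCatalan (w.length + 1) k) ^ 2 ∂P N) atTop (𝓝 0) := by
  -- with `c` the limit, `E[(m - c)²] = E[m²] - 2 c E[m] + c²`, and factorisation gives `E[m²] → c²`
  set c : ℂ := ((fussCatalan (w.length + 1) k : ℝ) : ℂ) with hc
  have hwick : (wick (powerWord w k) : ℂ) = c := by
    rw [wick_powerWord, hc, fussCatalan_eq_raney (Nat.succ_pos _)]
    push_cast
    rfl
  set u := powerWord w k with hu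
  have h1 := tendsto_gaussianExpectation_traceProd hG [u]
  have h2 := tendsto_gaussianExpectation_traceProd hG [u, u]
  have hlim := (h2.sub (h1.const_mul (2 * c))).add_const (c ^ 2)
  simp only [List.map_cons, List.map_nil, List.prod_cons, List.prod_nil, mul_one, hwick] at hlim
  rw [show c * c - 2 * c * c + c ^ 2 = 0 by ring] at hlim
  rw [← tendsto_ofReal_iff, Complex.ofReal_zero]
  refine hlim.congr fun N => ?_
  set E := gaussianExpectation (hG N).hasLaw_ginibreEntry with hE
  set Q : MvPolynomial ((ℕ × Fin N × Fin N) × Bool) ℂ :=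
    ((N : ℂ)⁻¹ • (genericWord u).trace - MvPolynomial.C c) ^ 2 with hQ
  have hEQ : E Q = ((N : ℂ) ^ 2)⁻¹ * E (traceProd N [u, u]) -
      2 * c * (((N : ℂ) ^ 1)⁻¹ * E (traceProd N [u])) + c ^ 2 := by
    have hE1 : E 1 = 1 := by simp [hE, gaussianExpectation]
    have hQ' : Q = ((N : ℂ) ^ 2)⁻¹ • traceProd N [u, u] -
        (2 * c * ((N : ℂ) ^ 1)⁻¹) • traceProd N [u] + (c ^ 2) • 1 := by
      rw [hQ]
      simp only [traceProd, List.map_cons, List.map_nil, List.prod_cons, List.prod_nil, mul_one,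
        MvPolynomial.smul_eq_C_mul, map_mul, map_pow, pow_one, ← inv_pow]
      have h2 : (MvPolynomial.C 2 : MvPolynomial ((ℕ × Fin N × Fin N) × Bool) ℂ) = 2 :=
        map_ofNat _ 2
      rw [h2]
      ring
    rw [hQ', map_add, map_sub, map_smul, map_smul, map_smul, hE1]
    simp only [smul_eq_mul]
    ring
  simp only [List.length_cons, List.length_nil, zero_add, Nat.reduceAdd]
  rw [← hEQ, hE]
  simp only [gaussianExpectation, LinearMap.coe_mk, AddHom.coe_mk]
  rw [← integral_complex_ofReal]
  refine integral_congr_ae (ae_of_all _ fun ω => ?_)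
  push_cast
  rw [integral_pow_squaredSingularValueMeasure, ← conjEval_trace_powerWord]
  simp [hQ, hu, conjEval, hc]

lemma hasAllMoments_moment {Ω : Type*} [MeasurableSpace Ω] {P : Measure Ω} [IsProbabilityMeasure P]
    {N : ℕ} {G : ℕ → Ω → Matrix (Fin N) (Fin N) ℂ} (hG : IsGinibreSequence G P) (w : List ℕ)
    (k : ℕ) : HasAllMoments P fun ω => ((∫ x, x ^ k ∂squaredSingularValueMeasure
      (wordMatrix (fun i => G i ω) w) : ℝ) : ℂ) := by
  simp only [integral_pow_squaredSingularValueMeasure, ← conjEval_trace_powerWord]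
  exact (HasAllMoments.const _).mul (hasAllMoments_conjEval hG.hasLaw_ginibreEntry _)

/-- Chebyshev's inequality turns `L²` convergence of the moments into convergence in probability. -/
lemma tendsto_measure_moment (hG : ∀ N, IsGinibreSequence (G N) (P N)) (w : List ℕ) (k : ℕ)
    {η : ℝ} (hη : 0 < η) :
    Tendsto (fun N => P N {ω | η ≤ |∫ x, x ^ k ∂squaredSingularValueMeasure
      (wordMatrix (fun i => G N i ω) w) - fussCatalan (w.length + 1) k|}) atTop (𝓝 0) := by
  have hlim := (tendsto_integral_sq_moment_sub hG w k).const_mul (η ^ 2)⁻¹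
  rw [mul_zero] at hlim
  have hlim' := ENNReal.tendsto_ofReal hlim
  rw [ENNReal.ofReal_zero] at hlim'
  refine tendsto_of_tendsto_of_tendsto_of_le_of_le tendsto_const_nhds hlim' (fun _ => zero_le)
    fun N => ?_
  have hm : HasAllMoments (P N) fun ω => ((∫ x, x ^ k ∂squaredSingularValueMeasure
      (wordMatrix (fun i => G N i ω) w) - fussCatalan (w.length + 1) k : ℝ) : ℂ) := by
    simpa [sub_eq_add_neg] using (hasAllMoments_moment (hG N) w k).add
      (.const (-(fussCatalan (w.length + 1) k : ℂ)))
  have hint : Integrable (fun ω => (∫ x, x ^ k ∂squaredSingularValueMeasure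
      (wordMatrix (fun i => G N i ω) w) - fussCatalan (w.length + 1) k) ^ 2) (P N) := by
    have := (hm.pow 2).integrable.re
    refine this.congr (ae_of_all _ fun ω => ?_)
    simp only [← Complex.ofReal_pow]
    exact Complex.ofReal_re _
  have hcheb := mul_meas_ge_le_integral_of_nonneg (ae_of_all _ fun ω => sq_nonneg _) hint (η ^ 2)
  have hset : {ω | η ≤ |∫ x, x ^ k ∂squaredSingularValueMeasure
      (wordMatrix (fun i => G N i ω) w) - fussCatalan (w.length + 1) k|} =
      {ω | η ^ 2 ≤ (∫ x, x ^ k ∂squaredSingularValueMeasure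
      (wordMatrix (fun i => G N i ω) w) - fussCatalan (w.length + 1) k) ^ 2} := by
    ext ω
    simp only [Set.mem_ofPred_eq]
    rw [sq_le_sq, abs_of_pos hη]
  rw [hset, ← ofReal_measureReal]
  refine ENNReal.ofReal_le_ofReal ?_
  rw [← div_eq_inv_mul, le_div_iff₀ (by positivity), mul_comm]
  exact hcheb

end Ginibre

theorem mainTheorem2 {Ω : ℕ → Type*} [∀ N, MeasurableSpace (Ω N)]
    (P : ∀ N, Measure (Ω N)) [∀ N, IsProbabilityMeasure (P N)]
    (G : ∀ N, ℕ → Ω N → Matrix (Fin N) (Fin N) ℂ)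
    (hG : ∀ N, IsGinibreSequence (G N) (P N)) (w : List ℕ) :
    (∃! ρ : Measure ℝ, IsFussCatalan (w.length + 1) ρ) ∧
      ∀ ρ : Measure ℝ, IsFussCatalan (w.length + 1) ρ →
        ConvergesWeaklyInProbability P
          (fun N ω => squaredSingularValueMeasure (wordMatrix (fun i => G N i ω) w)) ρ := by
  obtain ⟨ρ₀, hρ₀⟩ := exists_isFussCatalan w.length
  refine ⟨⟨ρ₀, hρ₀, fun ρ hρ => hρ₀.unique hρ⟩, fun ρ hρ f ε hε => ?_⟩
  -- only the moments up to order `D` matter, and each of them is far off with vanishing probability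
  obtain ⟨D, η, hη, H⟩ := hρ.exists_moments_near_imp f (half_pos hε)
  have hsum : Tendsto (fun N => ∑ k ∈ Finset.range (D + 1),
      P N {ω | η ≤ |∫ x, x ^ k ∂squaredSingularValueMeasure
        (wordMatrix (fun i => G N i ω) w) - fussCatalan (w.length + 1) k|}) atTop (𝓝 0) := by
    simpa using tendsto_finsetSum (Finset.range (D + 1))
      fun k _ => tendsto_measure_moment hG w k hη
  refine tendsto_of_tendsto_of_tendsto_of_le_of_le' tendsto_const_nhds hsum
    (Eventually.of_forall fun _ => zero_le) ?_
  filter_upwards [eventually_ne_atTop 0] with N hN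
  refine (measure_mono fun ω hω => ?_).trans (measure_biUnion_finset_le _ _)
  simp only [Set.mem_ofPred_eq] at hω
  by_contra hcon
  simp only [Set.mem_iUnion, Set.mem_ofPred_eq, not_exists, not_le] at hcon
  have h := H _ (hasFiniteMoments_squaredSingularValueMeasure hN
    (wordMatrix (fun i => G N i ω) w)) fun k hk =>
      (hcon k (Finset.mem_range.2 (Nat.lt_succ_of_le hk))).le
  linarith
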